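/- **Model.** Fix $\lambda>0$, $\beta>0$, $\alpha_L>0$, $\alpha_N>2$, $\theta\in[0,\pi]$, antenna gains $G>0$ (main lobe) and $g\ge 0$ (back lobe), transmit power $P_t>0$, path-loss intercept $A>0$, noise power $N_0>0$ (all in linear units), link length $r>0$ and an integer $N_h\ge 1$. Put $\ell_p(x)=e^{-\beta x}$ and $G_0=G^2$. The typical receiver is at the origin. The interferers form a homogeneous Poisson point process $\Phi=\{X_i\}$ on $\mathbb R^2$ with intensity $\lambda$; write $d_i=\|X_i\|$. Given $\Phi$, the following marks are independent over the interferers and of each other: the path-loss exponent $\alpha_i$, equal to $\alpha_L$ (LOS) with probability $\ell_p(d_i)$ and to $\alpha_N$ (NLOS) with probability $1-\ell_p(d_i)$; the antenna gain, equal to $M_{GG}=G^2$, $M_{Gg}=Gg$, $M_{gg}=g^2$ with probabilities $$p_{GG}=\Big(\frac{\theta}{\pi}\Big)^2,\qquad p_{Gg}=2\,\frac{\theta}{\pi}\,\frac{\pi-\theta}{\pi},\qquad p_{gg}=\Big(\frac{\pi-\theta}{\pi}\Big)^2;$$ and the fading power $h_i\sim\Gamma(N_h,1/N_h)$ (shape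 $N_h$, scale $1/N_h$). Independently of all this, the typical link of length $r$ has fading power $h_0\sim\Gamma(N_h,1/N_h)$ and, independently of $h_0$, path-loss exponent $\alpha_0=\alpha_L$ (LOS) with probability $\ell_p(r)$ and $\alpha_0=\alpha_N$ (NLOS) with probability $1-\ell_p(r)$. With $M_i$ now the gain of interferer $i$, let $$\mathrm{SINR}=\frac{P_tG_0h_0Ar^{-\alpha_0}}{N_0+\sum_{i\in\Phi}P_tM_ih_iAd_i^{-\alpha_i}},\qquad P_c(T)=\mathbb P[\mathrm{SINR}\ge T].$$ **Theorem 1.** Let $T>0$, $a=N_h(N_h!)^{-1/N_h}$ and, for $j\in\{L,N\}$ and $i\in\{GG,Gg,gg\}$, $$K_j=\frac{a r^{\alpha_j}}{P_tG_0A},\qquad Q_{j,i}=\frac{a r^{\alpha_j}M_i}{G_0}.$$ For $n\ge 1$ put $$\kappa_L=\sum_i p_i\int_0^\infty\Big[1-\Big(1+\frac{nQ_{L,i}T}{x^{\alpha_L}N_h}\Big)^{-N_h}\Big]\ell_p(x)\,x\,dx,\qquad \kappa_N=\sum_i p_i\int_0^\infty\Big[1-\Big(1+\frac{nQ_{L,i}T}{x^{\alpha_N}N_h}\Big)^{-N_h}\Big](1-\ell_p(x))\,x\,dx,$$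 $$\xi_L=\sum_i p_i\int_0^\infty\Big[1-\Big(1+\frac{nQ_{N,i}T}{x^{\alpha_L}N_h}\Big)^{-N_h}\Big]\ell_p(x)\,x\,dx,\qquad \xi_N=\sum_i p_i\int_0^\infty\Big[1-\Big(1+\frac{nQ_{N,i}T}{x^{\alpha_N}N_h}\Big)^{-N_h}\Big](1-\ell_p(x))\,x\,dx.$$ All these integrals converge, and if $N_h\ge 2$ then $$P_c(T)<\ell_p(r)\sum_{n=1}^{N_h}\binom{N_h}{n}(-1)^{n+1}e^{-nK_LTN_0}e^{-2\pi\lambda(\kappa_L+\kappa_N)}+(1-\ell_p(r))\sum_{n=1}^{N_h}\binom{N_h}{n}(-1)^{n+1}e^{-nK_NTN_0}e^{-2\pi\lambda(\xi_L+\xi_N)}.$$ If $N_h=1$, equality holds instead. -/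

import Mathlib

open MeasureTheory ProbabilityTheory
open scoped ENNReal

noncomputable section

namespace MmWave

/-- The three possible combinations of transmit and receive lobes on an interfering link. -/
inductive Lobes where
  | GG
  | Gg
  | gg
  deriving DecidableEq

instance : Fintype Lobes where
  elems := {.GG, .Gg, .gg}
  complete := by intro x; cases x <;> decide

instance : MeasurableSpace Lobes := ⊤

/-- The parameters of the network, all in linear units. -/
structure Params where
  /-- effective intensity of the Poisson process of interferers -/
  intensity : ℝ
  /-- blockage parameter -/
  β : ℝ
  /-- LOS path-loss exponent -/
  αL : ℝ
  /-- NLOS path-loss exponent -/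
  αN : ℝ
  /-- beamwidth -/
  θ : ℝ
  /-- main lobe gain -/
  G : ℝ
  /-- back lobe gain -/
  g : ℝ
  /-- transmit power -/
  Pt : ℝ
  /-- path-loss intercept -/
  A : ℝ
  /-- noise power -/
  N0 : ℝ
  /-- length of the typical dipole link -/
  r : ℝ
  /-- Nakagami parameter -/
  Nh : ℕ
  intensity_pos : 0 < intensity
  β_pos : 0 < β
  αL_pos : 0 < αL
  αN_gt : 2 < αN
  θ_nonneg : 0 ≤ θ
  θ_le : θ ≤ Real.pi
  G_pos : 0 < G
  g_nonneg : 0 ≤ g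
  Pt_pos : 0 < Pt
  A_pos : 0 < A
  N0_pos : 0 < N0
  r_pos : 0 < r
  Nh_pos : 1 ≤ Nh

/-- The Euclidean plane. -/
abbrev Plane : Type := EuclideanSpace ℝ (Fin 2)

/-- The marks of an interferer: whether its link is LOS, its lobes, and its fading power. -/
abbrev Mark : Type := Bool × Lobes × ℝ

namespace Params

variable (P : Params)

/-- The probability `ℓ_p(x)` that a link of length `x` is LOS. -/
def losProb (x : ℝ) : ℝ := Real.exp (-P.β * x)

/-- The path-loss exponent of a link that is LOS (`true`) or NLOS (`false`). -/
def pathLoss (los : Bool) : ℝ := if los then P.αL else P.αN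

/-- The probability that a link of length `x` has the given state. -/
def stateProb (los : Bool) (x : ℝ) : ℝ := if los then P.losProb x else 1 - P.losProb x

/-- The antenna gain `M_i` of an interfering link. -/
def gain : Lobes → ℝ
  | .GG => P.G * P.G
  | .Gg => P.G * P.g
  | .gg => P.g * P.g

/-- The antenna gain of the typical link: both main lobes are aligned. -/
def G0 : ℝ := P.G * P.G

/-- The probability `p_i` of each lobe combination. -/
def gainProb : Lobes → ℝ
  | .GG => (P.θ / Real.pi) ^ 2
  | .Gg => 2 * (P.θ / Real.pi) * ((Real.pi - P.θ) / Real.pi)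
  | .gg => ((Real.pi - P.θ) / Real.pi) ^ 2

/-- Law of the blockage state of a link of length `x`. -/
def stateLaw (x : ℝ) : Measure Bool :=
  ∑ b : Bool, ENNReal.ofReal (P.stateProb b x) • Measure.dirac b

/-- Law of the lobe combination of an interfering link. -/
def lobesLaw : Measure Lobes :=
  ∑ c : Lobes, ENNReal.ofReal (P.gainProb c) • Measure.dirac c

/-- Law of the fading power: gamma with shape `N_h` and scale `1 / N_h`, that is, rate `N_h`. -/
def fadingLaw : Measure ℝ := gammaMeasure P.Nh P.Nh

/-- Law of the marks of an interferer located at `x`, the receiver being at the origin. -/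
def markLaw (x : Plane) : Measure Mark :=
  (P.stateLaw ‖x‖).prod (P.lobesLaw.prod P.fadingLaw)

/-- Law of the blockage state and the fading power of the typical link. -/
def typicalLaw : Measure (Bool × ℝ) := (P.stateLaw P.r).prod P.fadingLaw

/-- `a = N_h (N_h!)^{-1/N_h}`. -/
def a : ℝ := P.Nh * (P.Nh.factorial : ℝ) ^ (-1 / (P.Nh : ℝ))

/-- `K_L` (for `true`) and `K_N` (for `false`). -/
def K (los₀ : Bool) : ℝ := P.a * P.r ^ P.pathLoss los₀ / (P.Pt * P.G0 * P.A)

/-- `Q_L` (for `true`) and `Q_N` (for `false`) for an interferer with lobes `i`. -/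
def Q (los₀ : Bool) (i : Lobes) : ℝ := P.a * P.r ^ P.pathLoss los₀ * P.gain i / P.G0

/-- The integrand of the exponents, for a typical link of state `los₀` and interferers of
state `los` with lobes `i`. -/
def integrand (T : ℝ) (n : ℕ) (los₀ los : Bool) (i : Lobes) (x : ℝ) : ℝ :=
  (1 - 1 / (1 + n * P.Q los₀ i * T / (x ^ P.pathLoss los * P.Nh)) ^ P.Nh)
    * P.stateProb los x * x

/-- Contribution of the interferers of state `los` to the exponent, for a typical link of
state `los₀`. -/
def exponent (T : ℝ) (n : ℕ) (los₀ los : Bool) : ℝ :=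
  ∑ i : Lobes, P.gainProb i * ∫ x in Set.Ioi (0 : ℝ), P.integrand T n los₀ los i x

/-- LOS interference, LOS typical link. -/
def κL (T : ℝ) (n : ℕ) : ℝ := P.exponent T n true true

/-- NLOS interference, LOS typical link. -/
def κN (T : ℝ) (n : ℕ) : ℝ := P.exponent T n true false

/-- LOS interference, NLOS typical link. -/
def ξL (T : ℝ) (n : ℕ) : ℝ := P.exponent T n false true

/-- NLOS interference, NLOS typical link. -/
def ξN (T : ℝ) (n : ℕ) : ℝ := P.exponent T n false false

/-- The bound on the CCDF of the SINR. -/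
def ccdfBound (T : ℝ) : ℝ :=
  (∑ n ∈ Finset.Icc 1 P.Nh, (P.Nh.choose n : ℝ) * (-1) ^ (n + 1)
      * Real.exp (-(n * P.K true * T * P.N0))
      * Real.exp (-(2 * Real.pi * P.intensity * (P.κL T n + P.κN T n)))) * P.losProb P.r
  + (∑ n ∈ Finset.Icc 1 P.Nh, (P.Nh.choose n : ℝ) * (-1) ^ (n + 1)
      * Real.exp (-(n * P.K false * T * P.N0))
      * Real.exp (-(2 * Real.pi * P.intensity * (P.ξL T n + P.ξN T n)))) * (1 - P.losProb P.r)

end Params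

/-- The random points `X 0, X 1, …` enumerate a homogeneous Poisson point process of the given
intensity on the plane: the numbers of points in disjoint bounded Borel sets are independent
and Poisson distributed with mean the intensity times the area. -/
structure IsPoissonProcess {Ω : Type*} [MeasurableSpace Ω] (μ : Measure Ω) (intensity : ℝ)
    (X : ℕ → Ω → Plane) : Prop where
  measurable : ∀ i, Measurable (X i)
  counts : ∀ (m : ℕ) (B : Fin m → Set Plane) (k : Fin m → ℕ),
    (∀ j, MeasurableSet (B j)) → (∀ j, Bornology.IsBounded (B j)) →
    Pairwise (fun j j' => Disjoint (B j) (B j')) →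
    μ {ω | ∀ j, {i | X i ω ∈ B j}.encard = k j} =
      ∏ j, ENNReal.ofReal (Real.exp (-(intensity * (volume (B j)).toReal))
        * (intensity * (volume (B j)).toReal) ^ k j / (k j).factorial)

/-- A realization of the network on a probability space, seen from the typical receiver at the
origin. -/
structure Network (P : Params) {Ω : Type*} [MeasurableSpace Ω] (μ : Measure Ω) where
  /-- locations of the interferers -/
  X : ℕ → Ω → Plane
  /-- whether the link from each interferer is LOS -/
  los : ℕ → Ω → Bool
  /-- lobes on the link from each interferer -/
  lobes : ℕ → Ω → Lobes
  /-- fading power on the link from each interferer -/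
  h : ℕ → Ω → ℝ
  /-- whether the typical link is LOS -/
  los₀ : Ω → Bool
  /-- fading power of the typical link -/
  h₀ : Ω → ℝ
  poisson : IsPoissonProcess μ P.intensity X
  measurable_los : ∀ i, Measurable (los i)
  measurable_lobes : ∀ i, Measurable (lobes i)
  measurable_h : ∀ i, Measurable (h i)
  measurable_los₀ : Measurable los₀
  measurable_h₀ : Measurable h₀
  /-- Conditionally on the locations, the marks of the interferers are independent, the mark at
  `x` having law `P.markLaw x`; the typical link is independent of all this and has law
  `P.typicalLaw`. -/
  law : ∀ (s : Finset ℕ) (B : Set (ℕ → Plane)) (E : ℕ → Set Mark) (D : Set (Bool × ℝ)),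
    MeasurableSet B → (∀ i, MeasurableSet (E i)) → MeasurableSet D →
    μ {ω | (fun i => X i ω) ∈ B ∧ (∀ i ∈ s, (los i ω, lobes i ω, h i ω) ∈ E i)
        ∧ (los₀ ω, h₀ ω) ∈ D} =
      (∫⁻ ω in {ω | (fun i => X i ω) ∈ B}, ∏ i ∈ s, P.markLaw (X i ω) (E i) ∂μ)
        * P.typicalLaw D

namespace Network

variable {P : Params} {Ω : Type*} [MeasurableSpace Ω] {μ : Measure Ω} (N : Network P μ)

/-- Received power of the desired signal. -/
def signal (ω : Ω) : ℝ :=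
  P.Pt * P.G0 * N.h₀ ω * P.A * P.r ^ (-P.pathLoss (N.los₀ ω))

/-- Total received interference power, a sum of nonnegative terms in `[0, ∞]`. -/
def interference (ω : Ω) : ℝ≥0∞ :=
  ∑' i, ENNReal.ofReal (P.Pt * P.gain (N.lobes i ω) * N.h i ω * P.A
    * ‖N.X i ω‖ ^ (-P.pathLoss (N.los i ω)))

/-- The signal to interference plus noise ratio. -/
def SINR (ω : Ω) : ℝ≥0∞ :=
  ENNReal.ofReal (N.signal ω) / (ENNReal.ofReal P.N0 + N.interference ω)

/-- The CCDF `P_c(T)` of the SINR. -/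
def ccdf (T : ℝ) : ℝ := μ.real {ω | ENNReal.ofReal T ≤ N.SINR ω}

end Network

end MmWave

end

/- Multiplied by `a`, the fading power `h₀` has a tail that Alzer's inequality bounds by
`1 - (1 - exp (-y)) ^ N_h`, strictly for `0 < y < ∞` when `N_h ≥ 2`, and with equality when
`N_h = 1`. The event `SINR ≥ T` says that `a h₀` reaches `y = K T (N₀ + I)`, where `I` is the
interference, independent of `h₀`. Expanding the power by the binomial formula turns the bound into
a combination of the Laplace transforms of `I` at `n K T`. The interferers are independently marked
Poisson points, so these are given by the Laplace functional of the Poisson process, and polar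
coordinates turn the integral over the plane into the exponents. Both sides of the tail bound vanish
at `y = ∞`; the inequality stays strict after integration because the Laplace transform of `I` is
nonzero, so that `I` is finite with positive probability. -/

noncomputable section

namespace MmWave

open Filter Topology

/-- The function `u ↦ exp (-u)` on `[0, ∞]`, vanishing at infinity: Laplace transforms of random
variables that may be infinite are integrals of it. -/
def expNeg (u : ℝ≥0∞) : ℝ := (EReal.exp (-(u : EReal))).toReal

/-- The function `v ↦ -log v` from `[0, 1]` to `[0, ∞]`, infinite at `0`: the inverse of
`expNeg`. -/
def negLog (v : ℝ) : ℝ≥0∞ := (-ENNReal.log (ENNReal.ofReal v)).toENNReal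

@[simp] lemma expNeg_zero : expNeg 0 = 1 := by simp [expNeg]

@[simp] lemma expNeg_top : expNeg ⊤ = 0 := by simp [expNeg]

lemma expNeg_of_ne_top {u : ℝ≥0∞} (hu : u ≠ ⊤) : expNeg u = Real.exp (-u.toReal) := by
  lift u to NNReal using hu
  have : ((u : ℝ≥0∞) : EReal) = ((u : ℝ) : EReal) := rfl
  rw [expNeg, this, ← EReal.coe_neg, EReal.exp_coe, ENNReal.toReal_ofReal (Real.exp_pos _).le]
  simp

lemma expNeg_ofReal {x : ℝ} (hx : 0 ≤ x) : expNeg (ENNReal.ofReal x) = Real.exp (-x) := by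
  rw [expNeg_of_ne_top ENNReal.ofReal_ne_top, ENNReal.toReal_ofReal hx]

lemma expNeg_nonneg (u : ℝ≥0∞) : 0 ≤ expNeg u := ENNReal.toReal_nonneg

lemma expNeg_add (u v : ℝ≥0∞) : expNeg (u + v) = expNeg u * expNeg v := by
  by_cases hu : u = ⊤
  · simp [hu]
  by_cases hv : v = ⊤
  · simp [hv]
  rw [expNeg_of_ne_top hu, expNeg_of_ne_top hv, expNeg_of_ne_top (ENNReal.add_ne_top.2 ⟨hu, hv⟩),
    ENNReal.toReal_add hu hv, neg_add, Real.exp_add]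

lemma expNeg_sum {ι : Type*} (s : Finset ι) (u : ι → ℝ≥0∞) :
    expNeg (∑ i ∈ s, u i) = ∏ i ∈ s, expNeg (u i) := by
  classical
  induction s using Finset.induction_on with
  | empty => simp
  | insert i s hi ih => rw [Finset.sum_insert hi, Finset.prod_insert hi, expNeg_add, ih]

lemma expNeg_natCast_mul (n : ℕ) (u : ℝ≥0∞) : expNeg (n * u) = expNeg u ^ n := by
  simpa using expNeg_sum (Finset.range n) fun _ => u

lemma antitone_expNeg : Antitone expNeg := by
  intro u v huv
  by_cases hv : v = ⊤
  · simp [hv, expNeg_nonneg]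
  · rw [expNeg_of_ne_top hv, expNeg_of_ne_top (ne_top_of_le_ne_top hv huv)]
    exact Real.exp_le_exp.2 (neg_le_neg (ENNReal.toReal_mono hv huv))

lemma expNeg_le_one (u : ℝ≥0∞) : expNeg u ≤ 1 := expNeg_zero ▸ antitone_expNeg zero_le

lemma expNeg_negLog {v : ℝ} (hv₀ : 0 ≤ v) (hv₁ : v ≤ 1) : expNeg (negLog v) = v := by
  have h : 0 ≤ -ENNReal.log (ENNReal.ofReal v) := by
    rw [EReal.neg_nonneg]
    exact ENNReal.log_le_zero_iff.2 (ENNReal.ofReal_le_one.2 hv₁)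
  rw [expNeg, negLog, EReal.coe_toENNReal h, neg_neg, ENNReal.exp_log, ENNReal.toReal_ofReal hv₀]

@[fun_prop] lemma continuous_expNeg : Continuous expNeg := by
  have h : Continuous fun u : ℝ≥0∞ => EReal.exp (-(u : EReal)) :=
    ENNReal.continuous_exp.comp (continuous_neg.comp continuous_coe_ennreal_ereal)
  refine continuous_iff_continuousAt.2 fun u => ?_
  refine (ENNReal.tendsto_toReal ?_).comp h.continuousAt
  rw [Ne, EReal.exp_eq_top_iff, EReal.neg_eq_top_iff]
  exact EReal.coe_ennreal_ne_bot u

@[fun_prop] lemma measurable_expNeg : Measurable expNeg := continuous_expNeg.measurable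

@[fun_prop] lemma measurable_negLog : Measurable negLog := by
  unfold negLog
  fun_prop

section

variable {Ω : Type*} [MeasurableSpace Ω] (μ : Measure Ω) [IsFiniteMeasure μ]

lemma integrable_expNeg {f : Ω → ℝ≥0∞} (hf : Measurable f) :
    Integrable (fun ω => expNeg (f ω)) μ := by
  refine Integrable.of_bound (measurable_expNeg.comp hf).aestronglyMeasurable 1
    (Eventually.of_forall fun ω => ?_)
  rw [Real.norm_of_nonneg (expNeg_nonneg _)]
  exact expNeg_le_one _

lemma integral_expNeg_le_one [IsProbabilityMeasure μ] {f : Ω → ℝ≥0∞} (hf : Measurable f) :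
    ∫ ω, expNeg (f ω) ∂μ ≤ 1 :=
  (integral_mono (integrable_expNeg μ hf) (integrable_const 1) fun ω => expNeg_le_one _).trans_eq
    (by simp)

lemma tendsto_integral_expNeg {f : ℕ → Ω → ℝ≥0∞} {g : Ω → ℝ≥0∞} (hf : ∀ n, Measurable (f n))
    (hfg : ∀ ω, Tendsto (fun n => f n ω) atTop (𝓝 (g ω))) :
    Tendsto (fun n => ∫ ω, expNeg (f n ω) ∂μ) atTop (𝓝 (∫ ω, expNeg (g ω) ∂μ)) := by
  refine tendsto_integral_of_dominated_convergence (fun _ => 1)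
    (fun n => (measurable_expNeg.comp (hf n)).aestronglyMeasurable)
    (integrable_const _) (fun n => Eventually.of_forall fun ω => ?_)
    (Eventually.of_forall fun ω => (continuous_expNeg.tendsto _).comp (hfg ω))
  rw [Real.norm_of_nonneg (expNeg_nonneg _)]
  exact expNeg_le_one _

end

lemma integral_pow_poissonMeasure (t : NNReal) (z : ℝ) :
    ∫ k, z ^ k ∂poissonMeasure t = Real.exp (-(t * (1 - z))) := by
  have h : HasSum (fun k : ℕ => Real.exp (-t) * ((t * z) ^ k / k.factorial))
      (Real.exp (-t) * Real.exp (t * z)) := by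
    rw [Real.exp_eq_exp_ℝ]
    exact (NormedSpace.expSeries_div_hasSum_exp (t * z : ℝ)).mul_left _
  rw [integral_poissonMeasure, show -(t * (1 - z)) = -t + t * z by ring, Real.exp_add, ← h.tsum_eq]
  refine tsum_congr fun k => ?_
  rw [mul_pow, smul_eq_mul]
  ring

/-- A random variable that charges the points `e b` with the masses of the law `ν` has no mass
left for other values. -/
lemma map_eq_map_of_measure_preimage_singleton {Ω β γ : Type*} [MeasurableSpace Ω]
    [MeasurableSpace β] [Countable β] [MeasurableSingletonClass β] [MeasurableSpace γ]
    [MeasurableSingletonClass γ] {μ : Measure Ω} [IsProbabilityMeasure μ] {ν : Measure β}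
    [IsProbabilityMeasure ν] {f : Ω → γ} (hf : Measurable f) {e : β → γ}
    (he : Function.Injective e) (h : ∀ b, μ (f ⁻¹' {e b}) = ν {b}) :
    μ.map f = ν.map e := by
  have he' : Measurable e := measurable_of_countable e
  have := Measure.isProbabilityMeasure_map (μ := μ) hf.aemeasurable
  have := Measure.isProbabilityMeasure_map (μ := ν) he'.aemeasurable
  refine (Measure.eq_of_le_of_measure_univ_eq (Measure.le_iff.2 fun S hS => ?_) (by simp)).symm
  have hdisj : (e ⁻¹' S).PairwiseDisjoint fun b => f ⁻¹' {e b} := fun b _ b' _ hbb' =>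
    Disjoint.preimage f (Set.disjoint_singleton.2 (he.ne hbb'))
  have hmass : ν (e ⁻¹' S) = μ (⋃ b ∈ e ⁻¹' S, f ⁻¹' {e b}) := by
    rw [measure_biUnion (Set.to_countable _) hdisj fun b _ => hf (measurableSet_singleton _)]
    simp_rw [h]
    rw [← measure_biUnion (Set.to_countable _) (fun b _ b' _ hbb' => by simpa using hbb')
      fun b _ => measurableSet_singleton b, Set.biUnion_of_singleton]
  rw [Measure.map_apply he' hS, Measure.map_apply hf hS, hmass]
  exact measure_mono (Set.iUnion₂_subset fun b hb ω hω => by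
    rw [Set.mem_preimage, Set.mem_singleton_iff.1 hω]
    exact hb)

lemma exists_simpleFunc_monotone_tendsto {u : Plane → ℝ≥0∞} (hu : Measurable u) :
    ∃ f : ℕ → SimpleFunc Plane ℝ≥0∞,
      (∀ n, Bornology.IsBounded (Function.support (f n))) ∧ (∀ x, Monotone fun n => f n x) ∧
        ∀ x, Tendsto (fun n => f n x) atTop (𝓝 (u x)) := by
  set f : ℕ → SimpleFunc Plane ℝ≥0∞ :=
    fun n => (SimpleFunc.eapprox u n).restrict (Metric.ball 0 n)
  have hf : ∀ n x, f n x = (Metric.ball 0 (n : ℝ)).indicator (SimpleFunc.eapprox u n) x :=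
    fun n x => SimpleFunc.restrict_apply _ Metric.isOpen_ball.measurableSet x
  refine ⟨f, fun n => ?_, fun x n m hnm => ?_, fun x => ?_⟩
  · refine (Metric.isBounded_ball (x := (0 : Plane)) (r := n)).subset fun x hx => ?_
    by_contra h
    exact hx (by rw [hf, Set.indicator_of_notMem h])
  · simp only [hf]
    refine (Set.indicator_le_indicator ((SimpleFunc.monotone_eapprox u hnm) x)).trans ?_
    exact Set.indicator_le_indicator_of_subset
      (Metric.ball_subset_ball (by exact_mod_cast hnm)) (fun _ => zero_le) x
  · refine (SimpleFunc.tendsto_eapprox hu x).congr' ?_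
    obtain ⟨n₀, hn₀⟩ := exists_nat_gt ‖x‖
    filter_upwards [eventually_ge_atTop n₀] with n hn
    rw [hf, Set.indicator_of_mem]
    rw [mem_ball_zero_iff]
    exact hn₀.trans_le (by exact_mod_cast hn)

/-- The point measure `∑ i, δ (X i)` of a random family of points: it counts the points in a set,
and integration against it is summation over the points. -/
def pointMeasure {Ω E : Type*} [MeasurableSpace E] (X : ℕ → Ω → E) (ω : Ω) : Measure E :=
  Measure.sum fun i => Measure.dirac (X i ω)

section PointMeasure

variable {Ω E : Type*} [MeasurableSpace E] {X : ℕ → Ω → E}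

lemma lintegral_pointMeasure {u : E → ℝ≥0∞} (hu : Measurable u) (ω : Ω) :
    ∫⁻ x, u x ∂pointMeasure X ω = ∑' i, u (X i ω) := by
  rw [pointMeasure, lintegral_sum_measure]
  simp_rw [lintegral_dirac' _ hu]

lemma pointMeasure_apply {B : Set E} (hB : MeasurableSet B) (ω : Ω) :
    pointMeasure X ω B = {i | X i ω ∈ B}.encard := by
  rw [pointMeasure, Measure.sum_apply _ hB, ← ENNReal.tsum_set_one,
    tsum_subtype {i | X i ω ∈ B} fun _ => (1 : ℝ≥0∞)]
  simp_rw [Measure.dirac_apply' _ hB]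
  rfl

lemma measurable_pointMeasure_apply [MeasurableSpace Ω] (hX : ∀ i, Measurable (X i)) {B : Set E}
    (hB : MeasurableSet B) : Measurable fun ω => pointMeasure X ω B := by
  simp_rw [pointMeasure, Measure.sum_apply _ hB, Measure.dirac_apply' _ hB]
  exact Measurable.tsum fun i => (measurable_one.indicator hB).comp (hX i)

end PointMeasure

namespace IsPoissonProcess

variable {Ω : Type*} [MeasurableSpace Ω] {μ : Measure Ω} [IsProbabilityMeasure μ]
  {intensity : ℝ} {X : ℕ → Ω → Plane}

lemma map_pointMeasure (hX : IsPoissonProcess μ intensity X) (hl : 0 ≤ intensity) {ι : Type*}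
    [Fintype ι] {B : ι → Set Plane} (hB : ∀ j, MeasurableSet (B j))
    (hb : ∀ j, Bornology.IsBounded (B j)) (hd : Pairwise fun j j' => Disjoint (B j) (B j')) :
    μ.map (fun ω j => pointMeasure X ω (B j)) =
      (Measure.pi fun j => poissonMeasure (intensity.toNNReal * (volume (B j)).toNNReal)).map
        fun k j => (k j : ℝ≥0∞) := by
  refine map_eq_map_of_measure_preimage_singleton
    (measurable_pi_iff.2 fun j => measurable_pointMeasure_apply hX.measurable (hB j))
    (fun k k' h => funext fun j => by exact_mod_cast congrFun h j) fun k => ?_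
  set e := Fintype.equivFin ι
  have hcounts := hX.counts _ (B ∘ e.symm) (k ∘ e.symm) (fun _ => hB _) (fun _ => hb _)
    fun j j' h => hd (e.symm.injective.ne h)
  have hset : (fun ω j => pointMeasure X ω (B j)) ⁻¹' {fun j => (k j : ℝ≥0∞)} =
      {ω | ∀ j, {i | X i ω ∈ (B ∘ e.symm) j}.encard = (k ∘ e.symm) j} := by
    ext ω
    simp only [Set.mem_preimage, Set.mem_singleton_iff, funext_iff, pointMeasure_apply (hB _),
      Set.mem_ofPred_eq, Function.comp_apply, ← ENat.toENNReal_coe, ENat.toENNReal_inj]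
    exact (e.symm.forall_congr_right (q := fun j => {i | X i ω ∈ B j}.encard = k j)).symm
  rw [hset, hcounts, Measure.pi_singleton]
  refine Fintype.prod_equiv e.symm _ _ fun j => ?_
  simp [poissonMeasure_singleton, hl, ENNReal.coe_toNNReal_eq_toReal]

lemma integral_expNeg_sum_pointMeasure (hX : IsPoissonProcess μ intensity X) (hl : 0 ≤ intensity)
    {ι : Type*} [Fintype ι] {B : ι → Set Plane} (y : ι → ℝ≥0∞) (hB : ∀ j, MeasurableSet (B j))
    (hb : ∀ j, Bornology.IsBounded (B j)) (hd : Pairwise fun j j' => Disjoint (B j) (B j')) :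
    ∫ ω, expNeg (∑ j, y j * pointMeasure X ω (B j)) ∂μ =
      expNeg (ENNReal.ofReal intensity *
        ∑ j, ENNReal.ofReal (1 - expNeg (y j)) * volume (B j)) := by
  have hmeas : Measurable fun c : ι → ℝ≥0∞ => expNeg (∑ j, y j * c j) := by fun_prop
  have hmean : ∀ j, Real.exp (-((intensity.toNNReal * (volume (B j)).toNNReal : NNReal)
      * (1 - expNeg (y j)))) = expNeg (ENNReal.ofReal intensity *
        (ENNReal.ofReal (1 - expNeg (y j)) * volume (B j))) := fun j => by
    have hvol : volume (B j) = ENNReal.ofReal (volume (B j)).toReal :=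
      (ENNReal.ofReal_toReal (hb j).measure_lt_top.ne).symm
    have hnonneg := sub_nonneg.2 (expNeg_le_one (y j))
    rw [hvol, ← ENNReal.ofReal_mul hnonneg, ← ENNReal.ofReal_mul hl, expNeg_ofReal (by positivity)]
    rw [NNReal.coe_mul, Real.coe_toNNReal _ hl, ENNReal.coe_toNNReal_eq_toReal,
      ENNReal.toReal_ofReal ENNReal.toReal_nonneg]
    ring_nf
  rw [← integral_map (φ := fun ω j => pointMeasure X ω (B j))
      (measurable_pi_iff.2 fun j => measurable_pointMeasure_apply hX.measurable (hB j)).aemeasurable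
      hmeas.aestronglyMeasurable, hX.map_pointMeasure hl hB hb hd,
    integral_map (measurable_of_countable _).aemeasurable hmeas.aestronglyMeasurable]
  simp_rw [expNeg_sum, mul_comm (y _), expNeg_natCast_mul]
  rw [integral_fintype_prod_eq_prod (fun j (k : ℕ) => expNeg (y j) ^ k), Finset.mul_sum, expNeg_sum]
  exact Finset.prod_congr rfl fun j _ => (integral_pow_poissonMeasure _ _).trans (hmean j)

lemma integral_expNeg_tsum_simpleFunc (hX : IsPoissonProcess μ intensity X) (hl : 0 ≤ intensity)
    (f : SimpleFunc Plane ℝ≥0∞) (hf : Bornology.IsBounded (Function.support f)) :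
    ∫ ω, expNeg (∑' i, f (X i ω)) ∂μ =
      expNeg (ENNReal.ofReal intensity * ∫⁻ x, ENNReal.ofReal (1 - expNeg (f x))) := by
  classical
  have hlint : ∀ (F : ℝ≥0∞ → ℝ≥0∞) (ν : Measure Plane), F 0 = 0 →
      ∫⁻ x, F (f x) ∂ν = ∑ y : f.range.erase 0, F y * ν (f ⁻¹' {(y : ℝ≥0∞)}) := by
    intro F ν hF
    rw [Finset.sum_coe_sort (f.range.erase 0) fun y => F y * ν (f ⁻¹' {y}),
      Finset.sum_erase _ (by simp [hF]), ← SimpleFunc.map_lintegral,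
      ← SimpleFunc.lintegral_eq_lintegral]
    rfl
  simp_rw [← lintegral_pointMeasure f.measurable, hlint (fun u => u) _ rfl,
    hlint (fun u => ENNReal.ofReal (1 - expNeg u)) volume (by simp)]
  refine hX.integral_expNeg_sum_pointMeasure hl _ (fun y => f.measurableSet_fiber _)
    (fun y => hf.subset fun x hx => ?_) fun y y' hyy' =>
      Disjoint.preimage f (Set.disjoint_singleton.2 (Subtype.coe_injective.ne hyy'))
  rw [Function.mem_support, Set.mem_singleton_iff.1 hx]
  exact Finset.ne_of_mem_erase y.2

theorem integral_expNeg_tsum (hX : IsPoissonProcess μ intensity X) (hl : 0 ≤ intensity)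
    {u : Plane → ℝ≥0∞} (hu : Measurable u) :
    ∫ ω, expNeg (∑' i, u (X i ω)) ∂μ =
      expNeg (ENNReal.ofReal intensity * ∫⁻ x, ENNReal.ofReal (1 - expNeg (u x))) := by
  obtain ⟨f, hb, hmono, hlim⟩ := exists_simpleFunc_monotone_tendsto hu
  have hsum : ∀ ω, Tendsto (fun n => ∑' i, f n (X i ω)) atTop (𝓝 (∑' i, u (X i ω))) := by
    intro ω
    simp_rw [← lintegral_pointMeasure hu, ← lintegral_pointMeasure (f _).measurable]
    exact lintegral_tendsto_of_tendsto_of_monotone (fun n => (f n).measurable.aemeasurable)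
      (Eventually.of_forall hmono) (Eventually.of_forall hlim)
  have hvol : Tendsto (fun n => ∫⁻ x, ENNReal.ofReal (1 - expNeg (f n x))) atTop
      (𝓝 (∫⁻ x, ENNReal.ofReal (1 - expNeg (u x)))) := by
    have hcont : Continuous fun v => ENNReal.ofReal (1 - expNeg v) :=
      ENNReal.continuous_ofReal.comp (by fun_prop)
    refine lintegral_tendsto_of_tendsto_of_monotone (fun n => by fun_prop)
      (Eventually.of_forall fun x n m hnm => ENNReal.ofReal_le_ofReal
        (sub_le_sub_left (antitone_expNeg (hmono x hnm)) 1))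
      (Eventually.of_forall fun x => (hcont.tendsto _).comp (hlim x))
  refine tendsto_nhds_unique (tendsto_integral_expNeg μ (fun n => Measurable.tsum fun i =>
    (f n).measurable.comp (hX.measurable i)) hsum) ?_
  exact ((continuous_expNeg.tendsto _).comp
    (ENNReal.Tendsto.const_mul hvol (Or.inr ENNReal.ofReal_ne_top))).congr fun n =>
      (hX.integral_expNeg_tsum_simpleFunc hl (f n) (hb n)).symm

end IsPoissonProcess

/-- A function on `(0, ∞)` that stays positive once it is nonnegative, so that it changes sign at
most once, from negative to positive. -/
def SingleCrossing (f : ℝ → ℝ) : Prop := ∀ ⦃x y⦄, 0 < x → x < y → 0 ≤ f x → 0 < f y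

namespace SingleCrossing

variable {f f' u v : ℝ → ℝ}

lemma of_strictMono (hf : StrictMono f) : SingleCrossing f :=
  fun _ _ _ hxy hfx => hfx.trans_lt (hf hxy)

lemma pos_mul (hf : SingleCrossing f) (hu : ∀ x, 0 < u x) :
    SingleCrossing fun x => u x * f x :=
  fun x y hx hxy h => mul_pos (hu y) (hf hx hxy (nonneg_of_mul_nonneg_right h (hu x)))

lemma pow_sub_pow {n : ℕ} (hn : n ≠ 0) (hu : ∀ x, 0 < x → 0 ≤ u x) (hv : ∀ x, 0 < x → 0 ≤ v x)
    (h : SingleCrossing fun x => u x - v x) : SingleCrossing fun x => u x ^ n - v x ^ n := by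
  intro x y hx hxy hpow
  have hle : v x ≤ u x := le_of_pow_le_pow_left₀ hn (hu x hx) (sub_nonneg.1 hpow)
  have hlt : v y < u y := sub_pos.1 (h hx hxy (sub_nonneg.2 hle))
  exact sub_pos.2 (pow_lt_pow_left₀ hlt (hv y (hx.trans hxy)) hn)

lemma strictMonoOn_of_deriv (hf' : SingleCrossing f') (hd : ∀ x, HasDerivAt f (f' x) x)
    (h0 : f 0 ≤ 0) {x : ℝ} (hx : 0 < x) (hfx : 0 ≤ f x) : StrictMonoOn f (Set.Ici x) := by
  have hc : Continuous f := continuous_iff_continuousAt.2 fun x => (hd x).continuousAt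
  obtain ⟨z, hz, hfz⟩ := exists_hasDerivAt_eq_slope f f' hx hc.continuousOn fun y _ => hd y
  have hf'z : 0 ≤ f' z := by
    rw [hfz]
    exact div_nonneg (by linarith) (by linarith)
  refine strictMonoOn_of_deriv_pos (convex_Ici x) hc.continuousOn fun y hy => ?_
  rw [interior_Ici, Set.mem_Ioi] at hy
  rw [(hd y).deriv]
  exact hf' hz.1 (hz.2.trans hy) hf'z

lemma of_deriv (hf' : SingleCrossing f') (hd : ∀ x, HasDerivAt f (f' x) x) (h0 : f 0 ≤ 0) :
    SingleCrossing f := fun _ _ hx hxy hfx =>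
  hfx.trans_lt (hf'.strictMonoOn_of_deriv hd h0 hx hfx Set.self_mem_Ici hxy.le hxy)

lemma neg_of_tendsto_zero (hf' : SingleCrossing f') (hd : ∀ x, HasDerivAt f (f' x) x)
    (h0 : f 0 ≤ 0) (hlim : Tendsto f atTop (𝓝 0)) {x : ℝ} (hx : 0 < x) : f x < 0 := by
  by_contra! hfx
  have hmono := hf'.strictMonoOn_of_deriv hd h0 hx hfx
  have hlt : f x < f (x + 1) := hmono Set.self_mem_Ici (by simp) (by linarith)
  have hle : f (x + 1) ≤ 0 := by
    refine ge_of_tendsto hlim ?_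
    filter_upwards [eventually_ge_atTop (x + 1)] with y hy
    exact hmono.monotoneOn (by simp) (Set.mem_Ici.2 (by linarith)) hy
  linarith

end SingleCrossing

lemma hasDerivAt_exp_mul (c x : ℝ) :
    HasDerivAt (fun x => Real.exp (c * x)) (c * Real.exp (c * x)) x := by
  simpa [mul_comm] using ((hasDerivAt_id x).const_mul c).exp

lemma singleCrossing_exp_sub_exp_sub_mul {c d : ℝ} (hc : 0 < c) (hdc : d < c) :
    SingleCrossing fun x => Real.exp (c * x) - Real.exp (d * x) - (c - d) * x := by
  have hf : ∀ x, HasDerivAt (fun x => Real.exp (c * x) - Real.exp (d * x) - (c - d) * x)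
      (c * Real.exp (c * x) - d * Real.exp (d * x) - (c - d)) x := fun x =>
    ((hasDerivAt_exp_mul c x).sub (hasDerivAt_exp_mul d x)).sub
      (by simpa using (hasDerivAt_id x).const_mul (c - d))
  have hf' : ∀ x, HasDerivAt (fun x => c * Real.exp (c * x) - d * Real.exp (d * x) - (c - d))
      (Real.exp (d * x) * (c ^ 2 * Real.exp ((c - d) * x) - d ^ 2)) x := fun x => by
    refine ((((hasDerivAt_exp_mul c x).const_mul c).sub
      ((hasDerivAt_exp_mul d x).const_mul d)).sub_const (c - d)).congr_deriv ?_
    rw [show c * x = d * x + (c - d) * x by ring, Real.exp_add]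
    ring
  have hmono : StrictMono fun x => c ^ 2 * Real.exp ((c - d) * x) - d ^ 2 := fun x y hxy => by
    have := sub_pos.2 hdc
    beta_reduce
    gcongr
  exact (((SingleCrossing.of_strictMono hmono).pos_mul fun x =>
    Real.exp_pos (d * x)).of_deriv hf'
    (by simp)).of_deriv hf (by simp)

lemma singleCrossing_one_sub_exp_sub_mul_exp {a c : ℝ} (ha : 0 < a) (hc : 0 < c) :
    SingleCrossing fun x => 1 - Real.exp (-(a * x)) - a * x * Real.exp (-(c * x)) := by
  convert (singleCrossing_exp_sub_exp_sub_mul hc (sub_lt_self c ha)).pos_mul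
    fun x => Real.exp_pos (-(c * x)) using 2 with x
  rw [mul_sub, mul_sub, ← Real.exp_add, ← Real.exp_add, neg_add_cancel, Real.exp_zero]
  ring_nf

section Gamma

variable {a r : ℝ}

lemma cdf_gammaMeasure_succ (n : ℕ) (hr : 0 < r) {y : ℝ} (hy : 0 ≤ y) :
    cdf (gammaMeasure (n + 1 : ℕ) r) y =
      ∫ t in (0 : ℝ)..y, r ^ (n + 1) / n.factorial * t ^ n * Real.exp (-(r * t)) := by
  have h : ∀ᵐ t, gammaPDFReal (n + 1 : ℕ) r t = (Set.Ioi 0).indicator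
      (fun t => r ^ (n + 1) / n.factorial * t ^ n * Real.exp (-(r * t))) t := by
    filter_upwards [Measure.ae_ne volume 0] with t ht
    rcases lt_or_gt_of_ne ht with h | h
    · rw [Set.indicator_of_notMem (by simpa using h.le), gammaPDFReal, if_neg (not_le.2 h)]
    · rw [Set.indicator_of_mem (by simpa using h), gammaPDFReal, if_pos h.le, Real.rpow_natCast,
        Nat.cast_succ, Real.Gamma_nat_eq_factorial, add_sub_cancel_right, Real.rpow_natCast]
  rw [cdf_gammaMeasure_eq_integral (by positivity) hr, intervalIntegral.integral_of_le hy,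
    integral_congr_ae (ae_restrict_of_ae h), setIntegral_indicator measurableSet_Ioi,
    Set.inter_comm, Set.Ioi_inter_Iic]

lemma hasDerivAt_one_sub_exp_pow_sub_integral {n : ℕ} (hn : n ≠ 0)
    (har : a ^ (n + 1) * (n + 1).factorial = r ^ (n + 1)) (x : ℝ) :
    HasDerivAt (fun x => (1 - Real.exp (-(a * x))) ^ (n + 1) -
        ∫ t in (0 : ℝ)..x, r ^ (n + 1) / n.factorial * t ^ n * Real.exp (-(r * t)))
      ((n + 1) * a * Real.exp (-(a * x)) * ((1 - Real.exp (-(a * x))) ^ n -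
        (a * x * Real.exp (-((r - a) / n * x))) ^ n)) x := by
  have hpow := ((hasDerivAt_exp_mul (-a) x).const_sub 1).pow (n + 1)
  have hcont : Continuous fun t => r ^ (n + 1) / n.factorial * t ^ n * Real.exp (-(r * t)) := by
    fun_prop
  have hcoef : r ^ (n + 1) / n.factorial = (n + 1) * a ^ (n + 1) := by
    rw [div_eq_iff (by positivity), ← har, Nat.factorial_succ]
    push_cast
    ring
  have hexp : Real.exp (-(r * x)) =
      Real.exp (-(a * x)) * Real.exp (-((r - a) / n * x)) ^ n := by
    rw [← Real.exp_nat_mul, ← Real.exp_add]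
    congr 1
    field_simp
    ring
  simp only [neg_mul] at hpow
  refine (hpow.sub (hcont.integral_hasStrictDerivAt 0 x).hasDerivAt).congr_deriv ?_
  rw [hcoef, hexp, mul_pow, mul_pow]
  push_cast
  ring

/-- **Alzer's inequality**. The difference of the two sides vanishes at `0` and at infinity, and its
derivative changes sign only once, from negative to positive. -/
theorem one_sub_exp_pow_lt_cdf_gammaMeasure {N : ℕ} (hN : 2 ≤ N) (ha : 0 < a) (hr : 0 < r)
    (har : a ^ N * N.factorial = r ^ N) {y : ℝ} (hy : 0 < y) :
    (1 - Real.exp (-(a * y))) ^ N < cdf (gammaMeasure N r) y := by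
  obtain ⟨n, rfl⟩ : ∃ n, N = n + 1 := ⟨N - 1, by lia⟩
  have hn : n ≠ 0 := by lia
  have hra : a < r := by
    refine lt_of_pow_lt_pow_left₀ (n + 1) hr.le (har ▸ lt_mul_of_one_lt_right (by positivity) ?_)
    exact_mod_cast Nat.one_lt_factorial.2 hN
  have hc : 0 < (r - a) / n := div_pos (sub_pos.2 hra) (by positivity)
  have hsign := (((singleCrossing_one_sub_exp_sub_mul_exp ha hc).pow_sub_pow hn
    (fun x hx => by simpa using (mul_pos ha hx).le) fun x hx => by positivity).pos_mul
      fun x => (by positivity : 0 < (n + 1) * a * Real.exp (-(a * x))))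
  have hlim : Tendsto (fun x => (1 - Real.exp (-(a * x))) ^ (n + 1) -
      ∫ t in (0 : ℝ)..x, r ^ (n + 1) / n.factorial * t ^ n * Real.exp (-(r * t)))
      atTop (𝓝 0) := by
    have hexp : Tendsto (fun x => Real.exp (-(a * x))) atTop (𝓝 0) :=
      Real.tendsto_exp_neg_atTop_nhds_zero.comp (tendsto_id.const_mul_atTop ha)
    have hdiff := ((hexp.const_sub 1).pow (n + 1)).sub
      (tendsto_cdf_atTop (gammaMeasure (n + 1 : ℕ) r))
    rw [sub_zero, one_pow, sub_self] at hdiff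
    refine hdiff.congr' ?_
    filter_upwards [eventually_ge_atTop 0] with x hx
    rw [cdf_gammaMeasure_succ n hr hx]
  rw [cdf_gammaMeasure_succ n hr hy.le, ← sub_neg]
  exact hsign.neg_of_tendsto_zero (hasDerivAt_one_sub_exp_pow_sub_integral hn har) (by simp)
    hlim hy

lemma gammaMeasure_real_Ici (ha : 0 < a) (hr : 0 < r) (y : ℝ) :
    (gammaMeasure a r).real (Set.Ici y) = 1 - cdf (gammaMeasure a r) y := by
  have := isProbabilityMeasure_gammaMeasure ha hr
  have h : (gammaMeasure a r).real (Set.Iic y) = (gammaMeasure a r).real (Set.Iio y) :=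
    measureReal_congr (Iio_ae_eq_Iic'
      (withDensity_absolutelyContinuous _ _ Real.volume_singleton)).symm
  rw [cdf_eq_real, h, ← Set.compl_Iio, probReal_compl_eq_one_sub measurableSet_Iio]

lemma setOf_le_ofReal_mul_eq_Ici (ha : 0 < a) {y : ℝ≥0∞} (hy₀ : y ≠ 0) (hy : y ≠ ⊤) :
    {h | y ≤ ENNReal.ofReal (a * h)} = Set.Ici (y.toReal / a) := by
  ext h
  rw [Set.mem_ofPred_eq, Set.mem_Ici, div_le_iff₀' ha, ← ENNReal.ofReal_toReal hy,
    ENNReal.ofReal_le_ofReal_iff', ENNReal.toReal_ofReal ENNReal.toReal_nonneg]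
  exact or_iff_left (ENNReal.toReal_pos hy₀ hy).not_ge

/-- The law of `a * h`, for `h` with law `ν`, charges `[y, ∞]` with this mass. -/
def scaledTail (ν : Measure ℝ) (a : ℝ) (y : ℝ≥0∞) : ℝ := ν.real {h | y ≤ ENNReal.ofReal (a * h)}

lemma antitone_scaledTail (ν : Measure ℝ) [IsFiniteMeasure ν] (a : ℝ) :
    Antitone (scaledTail ν a) :=
  fun _ _ h => measureReal_mono fun _ h' => h.trans h'

@[fun_prop] lemma measurable_scaledTail (ν : Measure ℝ) [IsFiniteMeasure ν] (a : ℝ) :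
    Measurable (scaledTail ν a) := (antitone_scaledTail ν a).measurable

@[simp] lemma scaledTail_zero (ν : Measure ℝ) [IsProbabilityMeasure ν] (a : ℝ) :
    scaledTail ν a 0 = 1 := by simp [scaledTail]

@[simp] lemma scaledTail_top (ν : Measure ℝ) (a : ℝ) : scaledTail ν a ⊤ = 0 := by
  simp [scaledTail]

lemma scaledTail_gammaMeasure_eq (ha : 0 < a) {s : ℝ} (hs : 0 < s) (hr : 0 < r) {y : ℝ≥0∞}
    (hy₀ : y ≠ 0) (hy : y ≠ ⊤) :
    scaledTail (gammaMeasure s r) a y = 1 - cdf (gammaMeasure s r) (y.toReal / a) := by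
  rw [scaledTail, setOf_le_ofReal_mul_eq_Ici ha hy₀ hy, gammaMeasure_real_Ici hs hr]

lemma scaledTail_gammaMeasure_one (hr : 0 < r) (y : ℝ≥0∞) :
    scaledTail (gammaMeasure 1 r) r y = expNeg y := by
  have := isProbabilityMeasure_gammaMeasure one_pos hr
  rcases eq_or_ne y 0 with rfl | hy₀
  · simp
  rcases eq_or_ne y ⊤ with rfl | hy
  · simp
  rw [scaledTail_gammaMeasure_eq hr one_pos hr hy₀ hy, ← expMeasure, cdf_expMeasure_eq hr,
    if_pos (by positivity), mul_div_cancel₀ _ hr.ne', sub_sub_cancel, expNeg_of_ne_top hy]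

lemma scaledTail_gammaMeasure_lt {N : ℕ} (hN : 2 ≤ N) (ha : 0 < a) (hr : 0 < r)
    (har : a ^ N * N.factorial = r ^ N) {y : ℝ≥0∞} (hy₀ : y ≠ 0) (hy : y ≠ ⊤) :
    scaledTail (gammaMeasure N r) a y < 1 - (1 - expNeg y) ^ N := by
  have halzer := one_sub_exp_pow_lt_cdf_gammaMeasure hN ha hr har
    (div_pos (ENNReal.toReal_pos hy₀ hy) ha)
  rw [mul_div_cancel₀ _ ha.ne', ← expNeg_of_ne_top hy] at halzer
  rw [scaledTail_gammaMeasure_eq ha (by positivity) hr hy₀ hy]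
  exact sub_lt_sub_left halzer 1

lemma scaledTail_gammaMeasure_le {N : ℕ} (hN : 2 ≤ N) (ha : 0 < a) (hr : 0 < r)
    (har : a ^ N * N.factorial = r ^ N) (y : ℝ≥0∞) :
    scaledTail (gammaMeasure N r) a y ≤ 1 - (1 - expNeg y) ^ N := by
  have := isProbabilityMeasure_gammaMeasure (a := N) (by positivity) hr
  rcases eq_or_ne y 0 with rfl | hy₀
  · simp [show N ≠ 0 by lia]
  rcases eq_or_ne y ⊤ with rfl | hy
  · simp
  exact (scaledTail_gammaMeasure_lt hN ha hr har hy₀ hy).le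

lemma measurable_gammaPDF (a r : ℝ) : Measurable (gammaPDF a r) :=
  (measurable_gammaPDFReal a r).ennreal_ofReal

lemma ae_nonneg_gammaMeasure (a r : ℝ) : ∀ᵐ h ∂gammaMeasure a r, 0 ≤ h := by
  rw [gammaMeasure, ae_withDensity_iff (measurable_gammaPDF a r)]
  refine Eventually.of_forall fun h hh => ?_
  by_contra! hneg
  exact hh (gammaPDF_of_neg hneg)

lemma integral_exp_neg_mul_gammaMeasure {t : ℝ} (ha : 0 < a) (hr : 0 < r) (ht : 0 ≤ t) :
    ∫ h, Real.exp (-(t * h)) ∂gammaMeasure a r = (r / (r + t)) ^ a := by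
  have hrt : 0 < r + t := by linarith
  have hdensity : ∀ x, (gammaPDF a r x).toReal • Real.exp (-(t * x)) = (Set.Ici 0).indicator
      (fun x => r ^ a / Real.Gamma a * (x ^ (a - 1) * Real.exp (-((r + t) * x)))) x := by
    intro x
    rw [gammaPDF, ENNReal.toReal_ofReal (gammaPDFReal_nonneg ha hr x), gammaPDFReal]
    by_cases hx : 0 ≤ x
    · rw [if_pos hx, Set.indicator_of_mem (Set.mem_Ici.2 hx), smul_eq_mul, add_mul, neg_add,
        Real.exp_add]
      ring
    · rw [if_neg hx, Set.indicator_of_notMem (by simpa using hx), zero_smul]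
  rw [gammaMeasure, integral_withDensity_eq_integral_toReal_smul
    (measurable_gammaPDF a r) (Eventually.of_forall fun _ => by
      simp [gammaPDF])]
  simp only [hdensity]
  rw [integral_indicator measurableSet_Ici, integral_Ici_eq_integral_Ioi, integral_const_mul,
    Real.integral_rpow_mul_exp_neg_mul_Ioi ha hrt, Real.div_rpow hr.le hrt.le,
    Real.div_rpow zero_le_one hrt.le, Real.one_rpow]
  have := (Real.Gamma_pos_of_pos ha).ne'
  field_simp

lemma integral_expNeg_mul_gammaMeasure {t : ℝ} (ha : 0 < a) (hr : 0 < r) (ht : 0 ≤ t) :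
    ∫ h, expNeg (ENNReal.ofReal (t * h)) ∂gammaMeasure a r = 1 / (1 + t / r) ^ a := by
  have hlaplace : ∀ᵐ h ∂gammaMeasure a r,
      expNeg (ENNReal.ofReal (t * h)) = Real.exp (-(t * h)) := by
    filter_upwards [ae_nonneg_gammaMeasure a r] with h hh
    exact expNeg_ofReal (mul_nonneg ht hh)
  rw [integral_congr_ae hlaplace, integral_exp_neg_mul_gammaMeasure ha hr ht,
    one_div, ← Real.inv_rpow (by positivity)]
  congr 1
  field_simp

end Gamma

section IndependentMarking

lemma integral_expNeg_tsum_infinitePi {β : ℕ → Type*} [∀ i, MeasurableSpace (β i)]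
    (ν : ∀ i, Measure (β i)) [∀ i, IsProbabilityMeasure (ν i)] {u : ∀ i, β i → ℝ≥0∞}
    (hu : ∀ i, Measurable (u i)) :
    ∫ y, expNeg (∑' i, u i (y i)) ∂Measure.infinitePi ν =
      expNeg (∑' i, negLog (∫ b, expNeg (u i b) ∂ν i)) := by
  have hfin : ∀ n, ∫ y, expNeg (∑ i ∈ Finset.range n, u i (y i)) ∂Measure.infinitePi ν =
      expNeg (∑ i ∈ Finset.range n, negLog (∫ b, expNeg (u i b) ∂ν i)) := by
    intro n
    have hprod := integral_restrict_infinitePi (μ := ν) (s := Finset.range n)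
      (f := fun y => ∏ i : Finset.range n, expNeg (u i (y i)))
      (Measurable.aestronglyMeasurable (by fun_prop))
    rw [integral_fintype_prod_eq_prod fun (i : Finset.range n) b => expNeg (u i b)] at hprod
    simp only [Finset.restrict] at hprod
    simp_rw [expNeg_sum, expNeg_negLog (integral_nonneg fun _ => expNeg_nonneg _)
      (integral_expNeg_le_one _ (hu _))]
    simpa only [← Finset.prod_coe_sort (Finset.range n)] using hprod
  have htsum : ∀ v : ℕ → ℝ≥0∞,
      Tendsto (fun n => ∑ i ∈ Finset.range n, v i) atTop (𝓝 (∑' i, v i)) :=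
    ENNReal.tendsto_nat_tsum
  refine tendsto_nhds_unique (tendsto_integral_expNeg _ (fun n => by fun_prop)
    fun y => htsum fun i => u i (y i)) ?_
  simp_rw [hfin]
  exact (continuous_expNeg.tendsto _).comp (htsum _)

variable {α β γ ι Ω : Type*} [MeasurableSpace α] [MeasurableSpace β] [MeasurableSpace γ]
  [MeasurableSpace Ω]

/-- The law of independent marks given the locations: the mark at the location `x i` has law
`κ (x i)`. -/
def marksKernel (ι : Type*) (κ : Kernel α β) [IsMarkovKernel κ] : Kernel (ι → α) (ι → β) where
  toFun x := Measure.infinitePi fun i => κ (x i)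
  measurable' := by
    refine Measurable.measure_of_isPiSystem_of_isProbabilityMeasure
      generateFrom_squareCylinders.symm
      (isPiSystem_squareCylinders (fun _ => MeasurableSpace.isPiSystem_measurableSet) (by simp)) ?_
    rintro _ ⟨s, E, hE, rfl⟩
    have hE' : ∀ i, MeasurableSet (E i) := fun i => hE i trivial
    simp_rw [Measure.infinitePi_pi _ fun i _ => hE' i]
    exact Finset.measurable_fun_prod _ fun i _ =>
      (κ.measurable_coe (hE' i)).comp (measurable_pi_apply i)

instance (κ : Kernel α β) [IsMarkovKernel κ] : IsMarkovKernel (marksKernel ι κ) :=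
  ⟨fun x => inferInstanceAs (IsProbabilityMeasure (Measure.infinitePi fun i => κ (x i)))⟩

lemma marksKernel_apply_pi (κ : Kernel α β) [IsMarkovKernel κ] (x : ι → α) (s : Finset ι)
    {E : ι → Set β} (hE : ∀ i, MeasurableSet (E i)) :
    marksKernel ι κ x ((s : Set ι).pi E) = ∏ i ∈ s, κ (x i) (E i) :=
  Measure.infinitePi_pi _ fun i _ => hE i

lemma ext_of_prod_pi_prod {ρ₁ ρ₂ : Measure ((α × (ι → β)) × γ)} [IsFiniteMeasure ρ₁]
    (h : ∀ (s : Finset ι) (B : Set α) (E : ι → Set β) (D : Set γ), MeasurableSet B →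
      (∀ i, MeasurableSet (E i)) → MeasurableSet D →
      ρ₁ ((B ×ˢ (s : Set ι).pi E) ×ˢ D) = ρ₂ ((B ×ˢ (s : Set ι).pi E) ×ˢ D)) : ρ₁ = ρ₂ := by
  have hcyl : IsCountablySpanning (squareCylinders fun _ : ι => {E : Set β | MeasurableSet E}) :=
    ⟨fun _ => Set.univ, fun _ => ⟨∅, fun _ => Set.univ, by simp, by simp⟩, Set.iUnion_const _⟩
  have hα := isCountablySpanning_measurableSet (α := α)
  have hγ := isCountablySpanning_measurableSet (α := γ)
  refine ext_of_generate_finite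
    (Set.image2 (· ×ˢ ·) (Set.image2 (· ×ˢ ·) {B : Set α | MeasurableSet B}
      (squareCylinders fun _ : ι => {E : Set β | MeasurableSet E})) {D : Set γ | MeasurableSet D})
    (generateFrom_eq_prod (generateFrom_eq_prod MeasurableSpace.generateFrom_measurableSet
      generateFrom_squareCylinders hα hcyl) MeasurableSpace.generateFrom_measurableSet
      (hα.prod hcyl) hγ).symm
    ((MeasurableSpace.isPiSystem_measurableSet.prod (isPiSystem_squareCylinders
      (fun _ => MeasurableSpace.isPiSystem_measurableSet) (by simp))).prod
      MeasurableSpace.isPiSystem_measurableSet) ?_ ?_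
  · rintro _ ⟨_, ⟨B, hB, _, ⟨s, E, hE, rfl⟩, rfl⟩, D, hD, rfl⟩
    exact h s B E D hB (fun i => hE i trivial) hD
  · simpa using h ∅ Set.univ (fun _ => Set.univ) Set.univ MeasurableSet.univ
      (fun _ => MeasurableSet.univ) MeasurableSet.univ

theorem IsPoissonProcess.integral_expNeg_tsum_marks {μ : Measure Ω} [IsProbabilityMeasure μ]
    {intensity : ℝ} {X : ℕ → Ω → Plane} (hX : IsPoissonProcess μ intensity X)
    (hl : 0 ≤ intensity) (κ : Kernel Plane β) [IsMarkovKernel κ] {u : Plane → β → ℝ≥0∞}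
    (hu : Measurable (Function.uncurry u)) :
    ∫ p, expNeg (∑' i, u (p.1 i) (p.2 i)) ∂(μ.map fun ω i => X i ω) ⊗ₘ marksKernel ℕ κ =
      expNeg (ENNReal.ofReal intensity *
        ∫⁻ x, ENNReal.ofReal (1 - ∫ b, expNeg (u x b) ∂κ x)) := by
  have hXm : Measurable fun ω i => X i ω := measurable_pi_lambda _ hX.measurable
  have := Measure.isProbabilityMeasure_map (μ := μ) hXm.aemeasurable
  have hum : Measurable fun p : (ℕ → Plane) × (ℕ → β) => ∑' i, u (p.1 i) (p.2 i) :=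
    Measurable.tsum fun i => hu.comp
      (by fun_prop : Measurable fun p : (ℕ → Plane) × (ℕ → β) => (p.1 i, p.2 i))
  have hmean : StronglyMeasurable fun x => ∫ b, expNeg (u x b) ∂κ x :=
    (measurable_expNeg.comp hu).stronglyMeasurable.integral_kernel_prod_right'
  have hv : Measurable fun x => negLog (∫ b, expNeg (u x b) ∂κ x) :=
    measurable_negLog.comp hmean.measurable
  rw [Measure.integral_compProd (integrable_expNeg _ hum)]
  have hmarks : ∀ x : ℕ → Plane, ∫ y, expNeg (∑' i, u (x i) (y i)) ∂marksKernel ℕ κ x =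
      expNeg (∑' i, negLog (∫ b, expNeg (u (x i) b) ∂κ (x i))) := fun x =>
    integral_expNeg_tsum_infinitePi _ fun i => hu.comp measurable_prodMk_left
  simp_rw [hmarks]
  have hvm : Measurable fun x : ℕ → Plane => ∑' i, negLog (∫ b, expNeg (u (x i) b) ∂κ (x i)) :=
    Measurable.tsum fun i => hv.comp (measurable_pi_apply i)
  rw [integral_map hXm.aemeasurable (Measurable.aestronglyMeasurable (by fun_prop)),
    hX.integral_expNeg_tsum hl hv]
  simp_rw [fun x => expNeg_negLog (integral_nonneg fun b => expNeg_nonneg (u x b))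
    (integral_expNeg_le_one (κ x) (hu.comp measurable_prodMk_left))]

end IndependentMarking

section FiniteLaw

variable {ι : Type*} [Fintype ι] [MeasurableSpace ι] {w : ι → ℝ}

lemma integral_sum_smul_dirac [MeasurableSingletonClass ι] (hw : ∀ i, 0 ≤ w i) (f : ι → ℝ) :
    ∫ i, f i ∂(∑ i, ENNReal.ofReal (w i) • Measure.dirac i) = ∑ i, w i * f i := by
  rw [integral_finsetSum_measure fun i _ => Integrable.of_finite.smul_measure ENNReal.ofReal_ne_top]
  refine Finset.sum_congr rfl fun i _ => ?_
  rw [integral_smul_measure, integral_dirac, ENNReal.toReal_ofReal (hw i), smul_eq_mul]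

lemma isProbabilityMeasure_sum_smul_dirac (hw : ∀ i, 0 ≤ w i) (hsum : ∑ i, w i = 1) :
    IsProbabilityMeasure (∑ i, ENNReal.ofReal (w i) • Measure.dirac i) :=
  ⟨by simp [← ENNReal.ofReal_sum_of_nonneg fun i _ => hw i, hsum]⟩

end FiniteLaw

section OneSubOneDivPow

variable {t : ℝ}

lemma one_sub_one_div_pow_nonneg (ht : 0 ≤ t) (N : ℕ) : 0 ≤ 1 - 1 / (1 + t) ^ N := by
  rw [sub_nonneg, div_le_one (by positivity)]
  exact one_le_pow₀ (by linarith)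

lemma one_sub_one_div_pow_le_one (ht : 0 ≤ t) (N : ℕ) : 1 - 1 / (1 + t) ^ N ≤ 1 := by
  rw [sub_le_self_iff]
  positivity

lemma one_sub_one_div_pow_le (ht : 0 ≤ t) (N : ℕ) : 1 - 1 / (1 + t) ^ N ≤ N * t := by
  have hinv : 1 - t ≤ 1 / (1 + t) := by
    rw [le_div_iff₀ (by positivity)]
    nlinarith [sq_nonneg t]
  have hbern := one_add_mul_le_pow (a := 1 / (1 + t) - 1)
    (by linarith [show 0 ≤ 1 / (1 + t) by positivity]) N
  rw [add_sub_cancel, div_pow, one_pow] at hbern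
  nlinarith [mul_le_mul_of_nonneg_left hinv (Nat.cast_nonneg (α := ℝ) N)]

variable {c α : ℝ} {w : ℝ → ℝ}

lemma integrableOn_one_sub_one_div_pow_mul_of_integrableOn (hc : 0 ≤ c) (N : ℕ)
    (hw : IntegrableOn (fun x => w x * x) (Set.Ioi 0)) :
    IntegrableOn (fun x => (1 - 1 / (1 + c / x ^ α) ^ N) * w x * x) (Set.Ioi 0) := by
  simp_rw [mul_assoc _ (w _)]
  refine Integrable.mono hw ((Measurable.aestronglyMeasurable (by fun_prop)).mul
    hw.aestronglyMeasurable) ((ae_restrict_iff' measurableSet_Ioi).2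
      (Eventually.of_forall fun x (hx : 0 < x) => ?_))
  have ht : 0 ≤ c / x ^ α := by positivity
  rw [norm_mul, Real.norm_of_nonneg (one_sub_one_div_pow_nonneg ht N)]
  exact mul_le_of_le_one_left (norm_nonneg _) (one_sub_one_div_pow_le_one ht N)

lemma integrableOn_one_sub_one_div_pow_mul_of_two_lt (hc : 0 ≤ c) (N : ℕ) (hα : 2 < α)
    (hw : Measurable w) (hw₀ : ∀ x > 0, 0 ≤ w x) (hw₁ : ∀ x > 0, w x ≤ 1) :
    IntegrableOn (fun x => (1 - 1 / (1 + c / x ^ α) ^ N) * w x * x) (Set.Ioi 0) := by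
  have hm : Measurable fun x => (1 - 1 / (1 + c / x ^ α) ^ N) * w x * x := by fun_prop
  have hnorm : ∀ x > 0, ‖(1 - 1 / (1 + c / x ^ α) ^ N) * w x * x‖ =
      (1 - 1 / (1 + c / x ^ α) ^ N) * w x * x := fun x hx =>
    Real.norm_of_nonneg (mul_nonneg (mul_nonneg
      (one_sub_one_div_pow_nonneg (by positivity) N) (hw₀ x hx)) hx.le)
  rw [← Set.Ioc_union_Ioi_eq_Ioi zero_le_one]
  refine IntegrableOn.union ?_ ?_
  · refine Measure.integrableOn_of_bounded (M := 1) (by simp) hm.aestronglyMeasurable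
      ((ae_restrict_iff' measurableSet_Ioc).2 (Eventually.of_forall fun x hx => ?_))
    rw [hnorm x hx.1]
    exact mul_le_one₀ (mul_le_one₀
      (one_sub_one_div_pow_le_one (div_nonneg hc (Real.rpow_nonneg hx.1.le _)) N)
      (hw₀ x hx.1) (hw₁ x hx.1)) hx.1.le hx.2
  · refine Integrable.mono' ((integrableOn_Ioi_rpow_of_lt (a := 1 - α) (by linarith)
      one_pos).const_mul (N * c)) hm.aestronglyMeasurable
      ((ae_restrict_iff' measurableSet_Ioi).2 (Eventually.of_forall fun x hx => ?_))
    have hx₀ : (0 : ℝ) < x := one_pos.trans hx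
    rw [hnorm x hx₀]
    calc (1 - 1 / (1 + c / x ^ α) ^ N) * w x * x ≤ N * (c / x ^ α) * 1 * x := by
          gcongr
          · exact hw₀ x hx₀
          · exact one_sub_one_div_pow_le (by positivity) N
          · exact hw₁ x hx₀
      _ = N * c * x ^ (1 - α) := by
          rw [Real.rpow_sub hx₀, Real.rpow_one]
          ring

end OneSubOneDivPow

section Polar

lemma integrable_plane_fun_norm_iff {f : ℝ → ℝ} :
    Integrable (fun x : Plane => f ‖x‖) ↔ IntegrableOn (fun ρ => ρ * f ρ) (Set.Ioi 0) := by
  simp [integrable_fun_norm_addHaar]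

lemma integral_plane_fun_norm (f : ℝ → ℝ) :
    ∫ x : Plane, f ‖x‖ = 2 * Real.pi * ∫ ρ in Set.Ioi (0 : ℝ), ρ * f ρ := by
  rw [integral_fun_norm_addHaar, measureReal_def, EuclideanSpace.volume_ball_fin_two]
  simp [ENNReal.toReal_ofReal Real.pi_pos.le, mul_assoc]

end Polar

namespace Params

variable (P : Params)

lemma losProb_pos (x : ℝ) : 0 < P.losProb x := Real.exp_pos _

lemma losProb_le_one {x : ℝ} (hx : 0 ≤ x) : P.losProb x ≤ 1 := by
  rw [losProb, Real.exp_le_one_iff, neg_mul, neg_nonpos]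
  exact mul_nonneg P.β_pos.le hx

lemma stateProb_nonneg (b : Bool) {x : ℝ} (hx : 0 ≤ x) : 0 ≤ P.stateProb b x := by
  cases b
  · simpa [stateProb] using P.losProb_le_one hx
  · simpa [stateProb] using (P.losProb_pos x).le

lemma sum_stateProb (x : ℝ) : ∑ b, P.stateProb b x = 1 := by
  simp [stateProb]

lemma stateProb_le_one (b : Bool) {x : ℝ} (hx : 0 ≤ x) : P.stateProb b x ≤ 1 :=
  (Finset.single_le_sum (fun b _ => P.stateProb_nonneg b hx) (Finset.mem_univ b)).trans_eq
    (P.sum_stateProb x)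

@[fun_prop]
lemma measurable_stateProb (b : Bool) : Measurable (P.stateProb b) := by
  have hlos : Measurable P.losProb := by
    unfold losProb
    fun_prop
  cases b
  · exact measurable_const.sub hlos
  · exact hlos

lemma gain_nonneg (i : Lobes) : 0 ≤ P.gain i := by
  have := P.G_pos
  have := P.g_nonneg
  cases i <;> simp only [gain] <;> positivity

lemma gainProb_nonneg (i : Lobes) : 0 ≤ P.gainProb i := by
  have := P.θ_nonneg
  have := sub_nonneg.2 P.θ_le
  have := Real.pi_pos
  cases i <;> simp only [gainProb] <;> positivity

lemma sum_gainProb : ∑ i, P.gainProb i = 1 := by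
  have huniv : (Finset.univ : Finset Lobes) = {.GG, .Gg, .gg} := rfl
  have := Real.pi_pos.ne'
  rw [huniv, Finset.sum_insert (by decide), Finset.sum_insert (by decide), Finset.sum_singleton]
  simp only [gainProb]
  field_simp
  ring

lemma Nh_cast_pos : (0 : ℝ) < P.Nh := by exact_mod_cast P.Nh_pos

lemma a_pos : 0 < P.a := by
  have := P.Nh_cast_pos
  have := P.Nh.factorial_pos
  unfold a
  positivity

lemma a_pow_mul_factorial : P.a ^ P.Nh * P.Nh.factorial = (P.Nh : ℝ) ^ P.Nh := by
  have hf : (0 : ℝ) < P.Nh.factorial := by exact_mod_cast P.Nh.factorial_pos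
  rw [a, mul_pow, ← Real.rpow_natCast (_ ^ (-1 / (P.Nh : ℝ))), ← Real.rpow_mul hf.le,
    div_mul_cancel₀ _ P.Nh_cast_pos.ne', Real.rpow_neg_one, mul_assoc, inv_mul_cancel₀ hf.ne',
    mul_one]

lemma G0_pos : 0 < P.G0 := mul_pos P.G_pos P.G_pos

lemma K_pos (b : Bool) : 0 < P.K b := by
  have := P.a_pos
  have := P.Pt_pos
  have := P.G0_pos
  have := P.A_pos
  have := P.r_pos
  unfold K
  positivity

lemma Q_nonneg (b : Bool) (i : Lobes) : 0 ≤ P.Q b i := by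
  have := P.a_pos
  have := P.G0_pos
  have := P.r_pos
  have := P.gain_nonneg i
  unfold Q
  positivity

lemma K_mul_gain (b : Bool) (i : Lobes) : P.K b * (P.Pt * P.gain i * P.A) = P.Q b i := by
  have := P.Pt_pos.ne'
  have := P.G0_pos.ne'
  have := P.A_pos.ne'
  unfold K Q
  field_simp

lemma integrableOn_integrand {T : ℝ} (hT : 0 ≤ T) (n : ℕ) (b₀ b : Bool) (i : Lobes) :
    IntegrableOn (P.integrand T n b₀ b i) (Set.Ioi 0) := by
  have hc : 0 ≤ n * P.Q b₀ i * T / P.Nh := by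
    have := P.Q_nonneg b₀ i
    positivity
  have hform : P.integrand T n b₀ b i = fun x =>
      (1 - 1 / (1 + n * P.Q b₀ i * T / P.Nh / x ^ P.pathLoss b) ^ P.Nh) * P.stateProb b x * x := by
    ext x
    rw [integrand, div_div, mul_comm (x ^ _)]
  rw [hform]
  cases b
  · exact integrableOn_one_sub_one_div_pow_mul_of_two_lt hc _ P.αN_gt (P.measurable_stateProb _)
      (fun x hx => P.stateProb_nonneg _ hx.le) fun x hx => P.stateProb_le_one _ hx.le
  · refine integrableOn_one_sub_one_div_pow_mul_of_integrableOn hc _ ?_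
    simpa [stateProb, losProb, mul_comm] using
      integrableOn_rpow_mul_exp_neg_mul_rpow (p := 1) (s := 1) (by norm_num) one_pos P.β_pos

instance : IsProbabilityMeasure P.lobesLaw :=
  isProbabilityMeasure_sum_smul_dirac P.gainProb_nonneg P.sum_gainProb

instance : IsProbabilityMeasure P.fadingLaw :=
  isProbabilityMeasure_gammaMeasure P.Nh_cast_pos P.Nh_cast_pos

lemma isProbabilityMeasure_stateLaw {x : ℝ} (hx : 0 ≤ x) : IsProbabilityMeasure (P.stateLaw x) :=
  isProbabilityMeasure_sum_smul_dirac (fun b => P.stateProb_nonneg b hx) (P.sum_stateProb x)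

instance : IsProbabilityMeasure P.typicalLaw := by
  have := P.isProbabilityMeasure_stateLaw P.r_pos.le
  unfold typicalLaw
  infer_instance

/-- The law of the blockage state of an interferer, as a kernel in its location. -/
def stateKernel : Kernel Plane Bool where
  toFun x := P.stateLaw ‖x‖
  measurable' := by
    refine Measure.measurable_of_measurable_coe _ fun s _ => ?_
    simp only [stateLaw, Measure.finsetSum_apply, Measure.smul_apply]
    fun_prop

instance : IsMarkovKernel P.stateKernel :=
  ⟨fun _ => P.isProbabilityMeasure_stateLaw (norm_nonneg _)⟩

/-- The law of the marks of an interferer, as a kernel in its location. -/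
def markKernel : Kernel Plane Mark := P.stateKernel ×ₖ Kernel.const _ (P.lobesLaw.prod P.fadingLaw)

instance : IsMarkovKernel P.markKernel := by
  unfold markKernel
  infer_instance

lemma markKernel_apply (x : Plane) : P.markKernel x = P.markLaw x :=
  Kernel.prod_apply ..

/-- The power received from an interferer at `x` with mark `m`. -/
def power (x : Plane) (m : Mark) : ℝ≥0∞ :=
  ENNReal.ofReal (P.Pt * P.gain m.2.1 * m.2.2 * P.A * ‖x‖ ^ (-P.pathLoss m.1))

lemma measurable_power : Measurable (Function.uncurry P.power) := by
  have hgain : Measurable fun p : Plane × Mark => P.gain p.2.2.1 :=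
    (measurable_of_countable P.gain).comp (by fun_prop)
  have hpath : Measurable fun p : Plane × Mark => P.pathLoss p.2.1 :=
    (measurable_of_countable P.pathLoss).comp (by fun_prop)
  simp only [Function.uncurry_def, power]
  fun_prop

/-- The Laplace transform at `s` of the power received from an interferer at distance `ρ`. -/
def powerLaplace (s ρ : ℝ) : ℝ :=
  ∑ b, P.stateProb b ρ * ∑ i, P.gainProb i *
    (1 / (1 + s * (P.Pt * P.gain i * P.A) * ρ ^ (-P.pathLoss b) / P.Nh) ^ P.Nh)

lemma integral_expNeg_mul_power {s : ℝ} (hs : 0 ≤ s) (x : Plane) :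
    ∫ m, expNeg (ENNReal.ofReal s * P.power x m) ∂P.markKernel x = P.powerLaplace s ‖x‖ := by
  have hm : Measurable fun m => ENNReal.ofReal s * P.power x m :=
    (P.measurable_power.comp measurable_prodMk_left).const_mul _
  have := P.isProbabilityMeasure_stateLaw (norm_nonneg x)
  have hlobes : ∀ b, Integrable (fun c => expNeg (ENNReal.ofReal s * P.power x (b, c)))
      (P.lobesLaw.prod P.fadingLaw) := fun b =>
    integrable_expNeg _ (hm.comp measurable_prodMk_left)
  rw [markKernel_apply, markLaw, integral_prod _ (integrable_expNeg _ hm), stateLaw,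
    integral_sum_smul_dirac fun b => P.stateProb_nonneg b (norm_nonneg x)]
  refine Finset.sum_congr rfl fun b _ => ?_
  rw [integral_prod _ (hlobes b), lobesLaw, integral_sum_smul_dirac P.gainProb_nonneg]
  congr 1
  refine Finset.sum_congr rfl fun i _ => ?_
  have hcoef : 0 ≤ s * (P.Pt * P.gain i * P.A) * ‖x‖ ^ (-P.pathLoss b) := by
    have := P.Pt_pos
    have := P.A_pos
    have := P.gain_nonneg i
    positivity
  rw [← Real.rpow_natCast, ← integral_expNeg_mul_gammaMeasure P.Nh_cast_pos P.Nh_cast_pos hcoef,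
    fadingLaw]
  congr 2 with h
  rw [power, ← ENNReal.ofReal_mul hs]
  congr 2
  ring

lemma powerLaplace_norm_le_one {s : ℝ} (hs : 0 ≤ s) (x : Plane) : P.powerLaplace s ‖x‖ ≤ 1 := by
  rw [← P.integral_expNeg_mul_power hs]
  exact integral_expNeg_le_one _
    ((P.measurable_power.comp measurable_prodMk_left).const_mul _)

lemma one_sub_powerLaplace (s ρ : ℝ) : 1 - P.powerLaplace s ρ =
    ∑ b, ∑ i, P.gainProb i * ((1 - 1 / (1 + s * (P.Pt * P.gain i * P.A)
      * ρ ^ (-P.pathLoss b) / P.Nh) ^ P.Nh) * P.stateProb b ρ) := by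
  have hone : (1 : ℝ) = ∑ b, P.stateProb b ρ * ∑ i, P.gainProb i * 1 := by
    simp only [mul_one, sum_gainProb, sum_stateProb]
  rw [powerLaplace]
  nth_rw 1 [hone]
  rw [← Finset.sum_sub_distrib]
  refine Finset.sum_congr rfl fun b _ => ?_
  rw [← mul_sub, ← Finset.sum_sub_distrib, Finset.mul_sum]
  refine Finset.sum_congr rfl fun i _ => ?_
  ring

lemma mul_one_sub_powerLaplace (T : ℝ) (n : ℕ) (b₀ : Bool) {ρ : ℝ} (hρ : 0 < ρ) :
    ρ * (1 - P.powerLaplace (n * P.K b₀ * T) ρ) =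
      ∑ b, ∑ i, P.gainProb i * P.integrand T n b₀ b i ρ := by
  rw [one_sub_powerLaplace, Finset.mul_sum]
  refine Finset.sum_congr rfl fun b _ => ?_
  rw [Finset.mul_sum]
  refine Finset.sum_congr rfl fun i _ => ?_
  have hratio : n * P.K b₀ * T * (P.Pt * P.gain i * P.A) * ρ ^ (-P.pathLoss b) / P.Nh =
      n * P.Q b₀ i * T / (ρ ^ P.pathLoss b * P.Nh) := by
    rw [← P.K_mul_gain, Real.rpow_neg hρ.le, ← div_eq_mul_inv, div_div]
    ring
  rw [integrand, hratio]
  ring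

lemma integrable_one_sub_powerLaplace {T : ℝ} (hT : 0 ≤ T) (n : ℕ) (b₀ : Bool) :
    Integrable fun x : Plane => 1 - P.powerLaplace (n * P.K b₀ * T) ‖x‖ := by
  rw [integrable_plane_fun_norm_iff (f := fun ρ => 1 - P.powerLaplace (n * P.K b₀ * T) ρ)]
  have hsum : IntegrableOn (fun ρ => ∑ b, ∑ i, P.gainProb i * P.integrand T n b₀ b i ρ)
      (Set.Ioi 0) :=
    integrable_finsetSum _ fun b _ => integrable_finsetSum _ fun i _ =>
      (P.integrableOn_integrand hT n b₀ b i).const_mul _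
  exact hsum.congr_fun (fun ρ hρ => (P.mul_one_sub_powerLaplace T n b₀ hρ).symm) measurableSet_Ioi

lemma integral_one_sub_powerLaplace {T : ℝ} (hT : 0 ≤ T) (n : ℕ) (b₀ : Bool) :
    ∫ x : Plane, (1 - P.powerLaplace (n * P.K b₀ * T) ‖x‖) =
      2 * Real.pi * (P.exponent T n b₀ true + P.exponent T n b₀ false) := by
  have hint : ∀ b i, IntegrableOn (fun ρ => P.gainProb i * P.integrand T n b₀ b i ρ) (Set.Ioi 0) :=
    fun b i => (P.integrableOn_integrand hT n b₀ b i).const_mul _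
  rw [integral_plane_fun_norm fun ρ => 1 - P.powerLaplace (n * P.K b₀ * T) ρ,
    setIntegral_congr_fun measurableSet_Ioi fun ρ hρ => P.mul_one_sub_powerLaplace T n b₀ hρ,
    integral_finsetSum _ fun b _ => integrable_finsetSum _ fun i _ => hint b i]
  simp_rw [integral_finsetSum _ fun i _ => hint _ i, integral_const_mul, Fintype.sum_bool]
  rfl

end Params

lemma sum_Icc_choose_mul_pow (N : ℕ) (e : ℝ) :
    ∑ n ∈ Finset.Icc 1 N, (N.choose n : ℝ) * (-1) ^ (n + 1) * e ^ n = 1 - (1 - e) ^ N := by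
  have hbinom := add_pow (-e) 1 N
  rw [Finset.range_eq_Ico, Finset.sum_eq_sum_Ico_succ_bot (by lia)] at hbinom
  rw [sub_eq_neg_add 1 e, hbinom, zero_add, ← Finset.Ico_add_one_right_eq_Icc]
  simp only [one_pow, mul_one, pow_zero, Nat.choose_zero_right, Nat.cast_one, sub_add_cancel_left,
    ← Finset.sum_neg_distrib]
  refine Finset.sum_congr rfl fun n _ => ?_
  rw [neg_pow e]
  ring

lemma measureReal_prod_apply {α β : Type*} [MeasurableSpace α] [MeasurableSpace β] (μ : Measure α)
    [IsFiniteMeasure μ] (ν : Measure β) [IsFiniteMeasure ν] {s : Set (α × β)}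
    (hs : MeasurableSet s) : (μ.prod ν).real s = ∫ x, ν.real (Prod.mk x ⁻¹' s) ∂μ := by
  rw [measureReal_def, Measure.prod_apply hs]
  exact (integral_toReal (measurable_measure_prodMk_left hs).aemeasurable
    (Eventually.of_forall fun _ => measure_lt_top _ _)).symm

section RandomThreshold

variable {Ω : Type*} [MeasurableSpace Ω] (μ : Measure Ω) [IsFiniteMeasure μ] {Y : Ω → ℝ≥0∞}

lemma integral_one_sub_one_sub_expNeg_pow (hY : Measurable Y) (N : ℕ) :
    ∫ ω, (1 - (1 - expNeg (Y ω)) ^ N) ∂μ =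
      ∑ n ∈ Finset.Icc 1 N, (N.choose n : ℝ) * (-1) ^ (n + 1) * ∫ ω, expNeg (n * Y ω) ∂μ := by
  simp_rw [← sum_Icc_choose_mul_pow, ← expNeg_natCast_mul]
  rw [integral_finsetSum _ fun n _ => (integrable_expNeg μ (hY.const_mul _)).const_mul _]
  simp_rw [integral_const_mul]

lemma integrable_one_sub_one_sub_expNeg_pow (hY : Measurable Y) (N : ℕ) :
    Integrable (fun ω => 1 - (1 - expNeg (Y ω)) ^ N) μ := by
  simp_rw [← sum_Icc_choose_mul_pow, ← expNeg_natCast_mul]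
  exact integrable_finsetSum _ fun n _ => (integrable_expNeg μ (hY.const_mul _)).const_mul _

lemma integrable_scaledTail (ν : Measure ℝ) [IsProbabilityMeasure ν] (a : ℝ) (hY : Measurable Y) :
    Integrable (fun ω => scaledTail ν a (Y ω)) μ := by
  refine Integrable.of_bound ((measurable_scaledTail ν a).comp hY).aestronglyMeasurable 1
    (Eventually.of_forall fun ω => ?_)
  rw [scaledTail, Real.norm_of_nonneg measureReal_nonneg]
  exact measureReal_le_one

theorem integral_scaledTail_gammaMeasure_lt {a r : ℝ} {N : ℕ} (hN : 2 ≤ N) (ha : 0 < a)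
    (hr : 0 < r) (har : a ^ N * N.factorial = r ^ N) (hY : Measurable Y) (hY₀ : ∀ ω, Y ω ≠ 0)
    (hY₁ : ∫ ω, expNeg (Y ω) ∂μ ≠ 0) :
    ∫ ω, scaledTail (gammaMeasure N r) a (Y ω) ∂μ < ∫ ω, (1 - (1 - expNeg (Y ω)) ^ N) ∂μ := by
  have := isProbabilityMeasure_gammaMeasure (a := N) (by positivity) hr
  have htail := integrable_scaledTail μ (gammaMeasure N r) a hY
  have hpow := integrable_one_sub_one_sub_expNeg_pow μ hY N
  have hle : ∀ ω, scaledTail (gammaMeasure N r) a (Y ω) ≤ 1 - (1 - expNeg (Y ω)) ^ N := fun ω =>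
    scaledTail_gammaMeasure_le hN ha hr har (Y ω)
  refine (integral_mono htail hpow hle).lt_of_ne fun heq => hY₁ ?_
  have htop : ∀ᵐ ω ∂μ, expNeg (Y ω) = 0 := by
    filter_upwards [(integral_eq_iff_of_ae_le htail hpow (Eventually.of_forall hle)).1 heq]
      with ω hω
    by_cases hYω : Y ω = ⊤
    · rw [hYω, expNeg_top]
    · exact absurd hω (scaledTail_gammaMeasure_lt hN ha hr har (hY₀ ω) hYω).ne
  rw [integral_congr_ae htop, integral_zero]

end RandomThreshold

namespace Params

variable (P : Params)

/-- The interference as a function of the locations and the marks of the interferers. -/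
def fieldInterference (p : (ℕ → Plane) × (ℕ → Mark)) : ℝ≥0∞ := ∑' i, P.power (p.1 i) (p.2 i)

lemma measurable_fieldInterference : Measurable P.fieldInterference :=
  Measurable.tsum fun i => P.measurable_power.comp
    (by fun_prop : Measurable fun p : (ℕ → Plane) × (ℕ → Mark) => (p.1 i, p.2 i))

/-- The level which `a * h₀` has to reach in order that the SINR be at least `T`, for a typical
link of state `b` and fading power `h₀` facing the interference `I`. -/
def load (T : ℝ) (b : Bool) (I : ℝ≥0∞) : ℝ≥0∞ :=
  ENNReal.ofReal (P.K b * T) * (ENNReal.ofReal P.N0 + I)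

@[fun_prop]
lemma measurable_load (T : ℝ) (b : Bool) : Measurable (P.load T b) := by
  unfold load
  fun_prop

variable {T : ℝ}

lemma ofReal_le_div_iff_load_le (T : ℝ) (b : Bool) (h : ℝ) (I : ℝ≥0∞) :
    ENNReal.ofReal T ≤ ENNReal.ofReal (P.Pt * P.G0 * h * P.A * P.r ^ (-P.pathLoss b))
      / (ENNReal.ofReal P.N0 + I) ↔ P.load T b I ≤ ENNReal.ofReal (P.a * h) := by
  have hsignal : P.a * h = P.K b * (P.Pt * P.G0 * h * P.A * P.r ^ (-P.pathLoss b)) := by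
    have := P.Pt_pos.ne'
    have := P.G0_pos.ne'
    have := P.A_pos.ne'
    have := (Real.rpow_pos_of_pos P.r_pos (P.pathLoss b)).ne'
    rw [K, Real.rpow_neg P.r_pos.le]
    field_simp
  have hnoise : ENNReal.ofReal P.N0 + I ≠ 0 := by simp [P.N0_pos]
  rw [ENNReal.le_div_iff_mul_le (Or.inl hnoise) (Or.inr ENNReal.ofReal_ne_top), load, hsignal,
    ENNReal.ofReal_mul (P.K_pos b).le, ENNReal.ofReal_mul (P.K_pos b).le,
    mul_assoc (ENNReal.ofReal (P.K b)),
    ENNReal.mul_le_mul_iff_right (by simpa using P.K_pos b) ENNReal.ofReal_ne_top]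

lemma load_ne_zero (hT : 0 < T) (b : Bool) (I : ℝ≥0∞) : P.load T b I ≠ 0 := by
  simp [load, P.N0_pos, mul_pos (P.K_pos b) hT]

lemma expNeg_natCast_mul_load (hT : 0 ≤ T) (n : ℕ) (b : Bool) (I : ℝ≥0∞) :
    expNeg (n * P.load T b I) = Real.exp (-(n * P.K b * T * P.N0)) *
      expNeg (ENNReal.ofReal (n * P.K b * T) * I) := by
  have hnKT : 0 ≤ n * P.K b * T := by
    have := P.K_pos b
    positivity
  have hcast : (n : ℝ≥0∞) * ENNReal.ofReal (P.K b * T) = ENNReal.ofReal (n * P.K b * T) := by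
    rw [mul_assoc, ENNReal.ofReal_mul n.cast_nonneg, ENNReal.ofReal_natCast]
  rw [load, ← mul_assoc, hcast, mul_add, expNeg_add, ← ENNReal.ofReal_mul hnKT,
    expNeg_ofReal (mul_nonneg hnKT P.N0_pos.le)]

lemma measurableSet_load_le (T : ℝ) : MeasurableSet {p : ℝ≥0∞ × (Bool × ℝ) |
    P.load T p.2.1 p.1 ≤ ENNReal.ofReal (P.a * p.2.2)} := by
  have hK : Measurable fun p : ℝ≥0∞ × (Bool × ℝ) => P.K p.2.1 :=
    (measurable_of_countable P.K).comp (by fun_prop)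
  unfold load
  exact measurableSet_le (by fun_prop) (by fun_prop)

lemma measureReal_prod_typicalLaw_load_le (T : ℝ) (ρ : Measure ℝ≥0∞) [IsFiniteMeasure ρ] :
    (ρ.prod P.typicalLaw).real {p | P.load T p.2.1 p.1 ≤ ENNReal.ofReal (P.a * p.2.2)} =
      ∑ b, P.stateProb b P.r * ∫ I, scaledTail P.fadingLaw P.a (P.load T b I) ∂ρ := by
  have := P.isProbabilityMeasure_stateLaw P.r_pos.le
  have hsection : ∀ I, P.typicalLaw.real
      (Prod.mk I ⁻¹' {p | P.load T p.2.1 p.1 ≤ ENNReal.ofReal (P.a * p.2.2)}) =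
      ∑ b, P.stateProb b P.r * scaledTail P.fadingLaw P.a (P.load T b I) := by
    intro I
    rw [typicalLaw, measureReal_prod_apply _ _ (measurable_prodMk_left (P.measurableSet_load_le T)),
      stateLaw, integral_sum_smul_dirac fun b => P.stateProb_nonneg b P.r_pos.le]
    rfl
  rw [measureReal_prod_apply _ _ (P.measurableSet_load_le T)]
  simp_rw [hsection]
  rw [integral_finsetSum _ fun b _ =>
    (integrable_scaledTail ρ P.fadingLaw P.a (P.measurable_load T b)).const_mul _]
  simp_rw [integral_const_mul]

end Params

namespace Network

variable {P : Params} {Ω : Type*} [MeasurableSpace Ω] {μ : Measure Ω} (N : Network P μ)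

/-- The locations and the marks of the interferers. -/
def field (ω : Ω) : (ℕ → Plane) × (ℕ → Mark) :=
  (fun i => N.X i ω, fun i => (N.los i ω, N.lobes i ω, N.h i ω))

/-- The state and the fading power of the typical link. -/
def typical (ω : Ω) : Bool × ℝ := (N.los₀ ω, N.h₀ ω)

lemma measurable_locations : Measurable fun ω i => N.X i ω :=
  measurable_pi_lambda _ N.poisson.measurable

@[fun_prop]
lemma measurable_field : Measurable N.field :=
  N.measurable_locations.prodMk <| measurable_pi_lambda _ fun i =>
    (N.measurable_los i).prodMk ((N.measurable_lobes i).prodMk (N.measurable_h i))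

@[fun_prop]
lemma measurable_typical : Measurable N.typical := N.measurable_los₀.prodMk N.measurable_h₀

lemma interference_eq : N.interference = fun ω => P.fieldInterference (N.field ω) := rfl

@[fun_prop]
lemma measurable_interference : Measurable N.interference := by
  rw [interference_eq]
  exact P.measurable_fieldInterference.comp N.measurable_field

lemma measurable_load_interference (T : ℝ) (b : Bool) :
    Measurable fun ω => P.load T b (N.interference ω) :=
  (P.measurable_load T b).comp N.measurable_interference

variable [IsProbabilityMeasure μ]

theorem map_field_typical : μ.map (fun ω => (N.field ω, N.typical ω)) =
    ((μ.map fun ω i => N.X i ω) ⊗ₘ marksKernel ℕ P.markKernel).prod P.typicalLaw := by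
  have := Measure.isProbabilityMeasure_map (μ := μ) N.measurable_locations.aemeasurable
  refine ext_of_prod_pi_prod fun s B E D hB hE hD => ?_
  have hpi : MeasurableSet ((s : Set ℕ).pi E) :=
    MeasurableSet.pi s.countable_toSet fun i _ => hE i
  have hprod : Measurable fun x : ℕ → Plane => ∏ i ∈ s, P.markKernel (x i) (E i) :=
    Finset.measurable_fun_prod _ fun i _ =>
      (P.markKernel.measurable_coe (hE i)).comp (measurable_pi_apply i)
  rw [Measure.map_apply (by fun_prop) ((hB.prod hpi).prod hD), Measure.prod_prod,
    Measure.compProd_apply_prod hB hpi]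
  simp_rw [marksKernel_apply_pi _ _ s hE]
  rw [setLIntegral_map hB hprod N.measurable_locations]
  simp_rw [P.markKernel_apply]
  have hset : (fun ω => (N.field ω, N.typical ω)) ⁻¹' ((B ×ˢ (s : Set ℕ).pi E) ×ˢ D) =
      {ω | (fun i => N.X i ω) ∈ B ∧ (∀ i ∈ s, (N.los i ω, N.lobes i ω, N.h i ω) ∈ E i) ∧
        (N.los₀ ω, N.h₀ ω) ∈ D} := by
    ext ω
    exact and_assoc
  rw [hset, N.law s B E D hB hE hD]
  rfl

lemma map_field :
    μ.map N.field = (μ.map fun ω i => N.X i ω) ⊗ₘ marksKernel ℕ P.markKernel := by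
  have := Measure.isProbabilityMeasure_map (μ := μ) N.measurable_locations.aemeasurable
  rw [← Measure.fst_map_prodMk N.measurable_typical, N.map_field_typical, Measure.fst_prod]

lemma map_interference_typical : μ.map (fun ω => (N.interference ω, N.typical ω)) =
    (μ.map N.interference).prod P.typicalLaw := by
  have := Measure.isProbabilityMeasure_map (μ := μ) N.measurable_field.aemeasurable
  have hmap := Measure.map_map (μ := μ) (P.measurable_fieldInterference.prodMap measurable_id)
    (N.measurable_field.prodMk N.measurable_typical)
  rw [N.map_field_typical, ← N.map_field, ← Measure.map_prod_map _ _
    P.measurable_fieldInterference measurable_id, Measure.map_id,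
    Measure.map_map P.measurable_fieldInterference N.measurable_field] at hmap
  exact hmap.symm

theorem integral_expNeg_mul_interference {s : ℝ} (hs : 0 ≤ s)
    (hint : Integrable fun x : Plane => 1 - P.powerLaplace s ‖x‖) :
    ∫ ω, expNeg (ENNReal.ofReal s * N.interference ω) ∂μ =
      Real.exp (-(P.intensity * ∫ x : Plane, (1 - P.powerLaplace s ‖x‖))) := by
  have hnonneg : ∀ x : Plane, 0 ≤ 1 - P.powerLaplace s ‖x‖ := fun x =>
    sub_nonneg.2 (P.powerLaplace_norm_le_one hs x)
  have hfield : ∫ ω, expNeg (ENNReal.ofReal s * N.interference ω) ∂μ =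
      ∫ p, expNeg (ENNReal.ofReal s * P.fieldInterference p) ∂μ.map N.field := by
    rw [integral_map N.measurable_field.aemeasurable
      (integrable_expNeg _ (P.measurable_fieldInterference.const_mul _)).1, interference_eq]
  rw [hfield, N.map_field]
  simp_rw [Params.fieldInterference, ← ENNReal.tsum_mul_left]
  rw [N.poisson.integral_expNeg_tsum_marks P.intensity_pos.le P.markKernel
    (u := fun x m => ENNReal.ofReal s * P.power x m) (P.measurable_power.const_mul _)]
  simp_rw [P.integral_expNeg_mul_power hs]
  rw [← ofReal_integral_eq_lintegral_ofReal hint (Eventually.of_forall hnonneg),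
    ← ENNReal.ofReal_mul P.intensity_pos.le,
    expNeg_ofReal (mul_nonneg P.intensity_pos.le (integral_nonneg hnonneg))]

theorem ccdf_eq_sum (T : ℝ) : N.ccdf T = ∑ b, P.stateProb b P.r *
    ∫ ω, scaledTail P.fadingLaw P.a (P.load T b (N.interference ω)) ∂μ := by
  have := Measure.isProbabilityMeasure_map (μ := μ) N.measurable_interference.aemeasurable
  have hevent : {ω | ENNReal.ofReal T ≤ N.SINR ω} = (fun ω => (N.interference ω, N.typical ω)) ⁻¹'
      {p | P.load T p.2.1 p.1 ≤ ENNReal.ofReal (P.a * p.2.2)} := by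
    ext ω
    exact P.ofReal_le_div_iff_load_le T _ _ _
  rw [ccdf, hevent, ← map_measureReal_apply
    (N.measurable_interference.prodMk N.measurable_typical) (P.measurableSet_load_le T),
    N.map_interference_typical, P.measureReal_prod_typicalLaw_load_le]
  refine Finset.sum_congr rfl fun b _ => ?_
  rw [integral_map N.measurable_interference.aemeasurable (integrable_scaledTail _ _ _
    (P.measurable_load T b)).1]

theorem integral_expNeg_natCast_mul_load {T : ℝ} (hT : 0 ≤ T) (n : ℕ) (b : Bool) :
    ∫ ω, expNeg (n * P.load T b (N.interference ω)) ∂μ = Real.exp (-(n * P.K b * T * P.N0)) *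
      Real.exp (-(2 * Real.pi * P.intensity *
        (P.exponent T n b true + P.exponent T n b false))) := by
  have hs : 0 ≤ n * P.K b * T := by
    have := P.K_pos b
    positivity
  simp_rw [P.expNeg_natCast_mul_load hT, integral_const_mul]
  rw [N.integral_expNeg_mul_interference hs (P.integrable_one_sub_powerLaplace hT n b),
    P.integral_one_sub_powerLaplace hT n b, ← mul_assoc, mul_comm P.intensity]

theorem ccdfBound_eq_sum {T : ℝ} (hT : 0 ≤ T) : P.ccdfBound T = ∑ b, P.stateProb b P.r *
    ∫ ω, (1 - (1 - expNeg (P.load T b (N.interference ω))) ^ P.Nh) ∂μ := by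
  simp_rw [fun b => integral_one_sub_one_sub_expNeg_pow μ
    (N.measurable_load_interference T b) P.Nh, N.integral_expNeg_natCast_mul_load hT,
    ← mul_assoc, Fintype.sum_bool, mul_comm (P.stateProb _ _)]
  rfl

theorem ccdf_lt_ccdfBound {T : ℝ} (hT : 0 < T) (hN : 2 ≤ P.Nh) : N.ccdf T < P.ccdfBound T := by
  rw [N.ccdf_eq_sum T, N.ccdfBound_eq_sum hT.le]
  have hlt : ∀ b, ∫ ω, scaledTail P.fadingLaw P.a (P.load T b (N.interference ω)) ∂μ <
      ∫ ω, (1 - (1 - expNeg (P.load T b (N.interference ω))) ^ P.Nh) ∂μ := by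
    intro b
    have hload : ∫ ω, expNeg (P.load T b (N.interference ω)) ∂μ ≠ 0 := by
      have h := N.integral_expNeg_natCast_mul_load hT.le 1 b
      rw [Nat.cast_one] at h
      simp_rw [one_mul] at h
      rw [h]
      positivity
    exact integral_scaledTail_gammaMeasure_lt μ hN P.a_pos P.Nh_cast_pos P.a_pow_mul_factorial
      (N.measurable_load_interference T b) (fun ω => P.load_ne_zero hT b _) hload
  exact Finset.sum_lt_sum
    (fun b _ => mul_le_mul_of_nonneg_left (hlt b).le (P.stateProb_nonneg b P.r_pos.le))
    ⟨true, Finset.mem_univ _, mul_lt_mul_of_pos_left (hlt true) (P.losProb_pos P.r)⟩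

theorem ccdf_eq_ccdfBound {T : ℝ} (hT : 0 ≤ T) (hN : P.Nh = 1) : N.ccdf T = P.ccdfBound T := by
  have ha : P.a = 1 := by simp [Params.a, hN]
  rw [N.ccdf_eq_sum T, N.ccdfBound_eq_sum hT]
  simp only [Params.fadingLaw, hN, ha, Nat.cast_one, pow_one, sub_sub_cancel,
    scaledTail_gammaMeasure_one one_pos]

end Network

end MmWave

end

theorem theorem1 (P : MmWave.Params) {Ω : Type*} [MeasurableSpace Ω] (μ : Measure Ω)
    [IsProbabilityMeasure μ] (N : MmWave.Network P μ) (T : ℝ) (hT : 0 < T) :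
    (∀ (n : ℕ) (los₀ los : Bool) (i : MmWave.Lobes),
      IntegrableOn (P.integrand T n los₀ los i) (Set.Ioi 0)) ∧
    (2 ≤ P.Nh → N.ccdf T < P.ccdfBound T) ∧
    (P.Nh = 1 → N.ccdf T = P.ccdfBound T) := by
  exact ⟨P.integrableOn_integrand hT.le, N.ccdf_lt_ccdfBound hT, N.ccdf_eq_ccdfBound hT.le⟩
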